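/- Let $M$ be a smooth $n$-manifold without boundary (Hausdorff, second countable; for instance compact, or $\mathbb R^n$) and write $\mathbb R_+=(0,\infty)$. For a manifold $Q$, a smooth function $g:Q\times\mathbb R^N\to\mathbb R$ is a *generating family* if $0$ is a regular value of $\partial_\eta g:Q\times\mathbb R^N\to(\mathbb R^N)^*$; put $\Sigma_g=(\partial_\eta g)^{-1}(0)$, and for $(q,\eta)\in\Sigma_g$ put $i_g(q,\eta)=(q,\partial_q g(q,\eta))\in T^*Q$ and $j_g(q,\eta)=(q,\partial_q g(q,\eta),g(q,\eta))\in J^1Q$. It generates the immersed Lagrangian $i_g(\Sigma_g)$ and the immersed Legendrian $j_g(\Sigma_g)$. A function on $M\times\mathbb R^N$ is *linear-at-infinity* if it equals a nonzero linear function of $\eta$ outside a compact set. Identify the symplectization $\mathbb R\times J^1M$ with $T^*(\mathbb R_+\times M)$ by $(s,(x,y,z))\mapsto(e^s,x;\,z\,dt+e^s y)$, so that the cylinder over $\Lambda\subset J^1M$ is $\{(t,x;\,z\,dt+t\,y):t>0,\ (x,y,z)\in\Lambda\}$. **Proposition.** Let $\Lambda\subset J^1M$ be a Legendrian generated by a linear-at-infinity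 generating family $f:M\times\mathbb R^N\to\mathbb R$. Then $(\Lambda,f)$ has an immersed gf-compatible Lagrangian filling $\emptyset\prec_{(\overline L,F)}(\Lambda,f)$. That is, there are a nonzero linear function $A:\mathbb R^N\to\mathbb R$ with $f(x,\eta)=A(\eta)$ outside a compact set, a generating family $F:(\mathbb R_+\times M)\times\mathbb R^N\to\mathbb R$ with $\overline L=i_F(\Sigma_F)\subset T^*(\mathbb R_+\times M)$, and numbers $0<t_-<t_+$ such that 1. $\Sigma_F$ is an embedded $(n+1)$-dimensional submanifold and $i_F:\Sigma_F\to T^*(\mathbb R_+\times M)$ is a Lagrangian immersion; 2. $F(t,x,\eta)=t\,A(\eta)$ for $t\le t_-$, and $F(t,x,\eta)=t\,f(x,\eta)$ for $t\ge t_+$; 3. for every $t>0$ the function $F(t,\cdot,\cdot)$ is linear-at-infinity; 4. $\overline L$ is empty over $\{t\le t_-\}$, coincides with the cylinder over $\Lambda$ over $\{t\ge t_+\}$, and the part of $\Sigma_F$ over $[t_-,t_+]$ is compact. Moreover, $F$ can be taken of the form $$F(t,x,\eta)=t\big(\sigma(t)f(x,\eta)+(1-\sigma(t))A(\eta)\big)-\varepsilon(t)\cdot\eta,$$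 where $\sigma:\mathbb R\to\mathbb R$ is smooth and nondecreasing with $\sigma=0$ on $(-\infty,1]$ and $\sigma=1$ on $[2,\infty)$, and $\varepsilon:\mathbb R\to(\mathbb R^N)^*$ is a smooth path of regular values of $\partial_\eta f$. -/

import Mathlib

open Set Manifold Topology Bundle
open scoped ContDiff Manifold

noncomputable section

namespace GF

/-- `ℝ₊ = (0, ∞)`, as an open submanifold of `ℝ`. -/
def RPos : TopologicalSpace.Opens ℝ := ⟨Ioi 0, isOpen_Ioi⟩

section Bundles

variable {E : Type*} [NormedAddCommGroup E] [NormedSpace ℝ E]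
  {H : Type*} [TopologicalSpace H] (I : ModelWithCorners ℝ E H)
  (Q : Type*) [TopologicalSpace Q] [ChartedSpace H Q] [IsManifold I ∞ Q]

/-- The cotangent bundle `T*Q`, as the total space of the dual of the tangent bundle
(with Mathlib's smooth structure on the bundle of continuous linear maps). -/
abbrev Cotangent : Type _ :=
  TotalSpace (E →L[ℝ] ℝ) (fun q : Q => TangentSpace I q →L[ℝ] ℝ)

/-- The model with corners of `T*Q`. -/
abbrev cotModel : ModelWithCorners ℝ (E × (E →L[ℝ] ℝ)) (ModelProd H (E →L[ℝ] ℝ)) :=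
  I.prod 𝓘(ℝ, E →L[ℝ] ℝ)

/-- The `1`-jet bundle `J¹Q = T*Q × ℝ`; a point is `((x, y), z)`. -/
abbrev OneJet : Type _ := Cotangent I Q × ℝ

variable {Q}

/-- The canonical (Liouville) `1`-form `λ` on `T*Q`: `λ_α (w) = α (dπ w)`, where `π : T*Q → Q`.
The canonical symplectic form is `dλ` (up to the sign convention). -/
def liouville (α : Cotangent I Q) : TangentSpace (cotModel I) α →L[ℝ] ℝ :=
  (α.2 : TangentSpace I α.1 →L[ℝ] ℝ).comp
    (mfderiv (cotModel I) I (fun β : Cotangent I Q => β.1) α)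

end Bundles

section Submanifolds

variable {D : Type*} [NormedAddCommGroup D] [NormedSpace ℝ D]
  {E' : Type*} [NormedAddCommGroup E'] [NormedSpace ℝ E']
  {H' : Type*} [TopologicalSpace H'] (J : ModelWithCorners ℝ E' H')
  {X : Type*} [TopologicalSpace X] [ChartedSpace H' X]

/-- `φ`, restricted to the open subset `U` of the vector space `D`, is a smooth local
parametrization of the subset `S` of the manifold `X`: a smooth immersion which is a homeomorphism
from `U` onto a relatively open subset of `S`. -/
structure IsLocalParametrization (S : Set X) (U : Set D) (φ : D → X) : Prop where
  isOpen : IsOpen U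
  smooth : ContMDiffOn 𝓘(ℝ, D) J ∞ φ U
  immersion : ∀ u ∈ U, Function.Injective (mfderiv 𝓘(ℝ, D) J φ u)
  embedding : IsEmbedding (U.domRestrict φ)
  image_eq : ∃ W : Set X, IsOpen W ∧ φ '' U = S ∩ W

variable (D) in
/-- `S` is a smooth embedded submanifold of `X` of dimension `dim D`. -/
def IsEmbeddedSubmanifold (S : Set X) : Prop :=
  ∀ p ∈ S, ∃ (U : Set D) (φ : D → X), IsLocalParametrization J S U φ ∧ p ∈ φ '' U

variable {E : Type*} [NormedAddCommGroup E] [NormedSpace ℝ E]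
  {H : Type*} [TopologicalSpace H] (I : ModelWithCorners ℝ E H)
  {Q : Type*} [TopologicalSpace Q] [ChartedSpace H Q] [IsManifold I ∞ Q]

/-- The pullback `ψ^* λ` of the Liouville form under a map `ψ` from a vector space to `T*Q`. -/
def pullbackLiouville (ψ : D → Cotangent I Q) (u : D) : D →L[ℝ] ℝ :=
  (liouville I (ψ u)).comp (mfderiv 𝓘(ℝ, D) (cotModel I) ψ u)

/-- `ι` restricts to a Lagrangian immersion of the submanifold `S ⊆ X` into `T*Q`:
`S` is an embedded submanifold of `X` with `dim S = dim Q` (the model space of `S` is that of `Q`),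
and in every local parametrization of `S` the map `ι` is smooth, has injective differential, and
pulls back the symplectic form `dλ` to zero, i.e. `d(ι^* λ) (v, w) = 0` for all `v`, `w`. -/
def IsLagrangianImmersion (S : Set X) (ι : X → Cotangent I Q) : Prop :=
  IsEmbeddedSubmanifold E J S ∧
  ∀ (U : Set E) (φ : E → X), IsLocalParametrization J S U φ →
    ContMDiffOn 𝓘(ℝ, E) (cotModel I) ∞ (ι ∘ φ) U ∧
    (∀ u ∈ U, Function.Injective (mfderiv 𝓘(ℝ, E) (cotModel I) (ι ∘ φ) u)) ∧
    ∀ u ∈ U, ∀ v w : E,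
      fderiv ℝ (pullbackLiouville I (ι ∘ φ)) u v w
        - fderiv ℝ (pullbackLiouville I (ι ∘ φ)) u w v = 0

end Submanifolds

section GeneratingFamilies

variable {E : Type*} [NormedAddCommGroup E] [NormedSpace ℝ E]
  {H : Type*} [TopologicalSpace H] (I : ModelWithCorners ℝ E H)
  {Q : Type*} [TopologicalSpace Q] [ChartedSpace H Q]
  {V : Type*} [NormedAddCommGroup V] [NormedSpace ℝ V]

/-- `∂_η f : Q × V → V*`, the derivative of `f` in the fibre variable. -/
def dFiber (f : Q × V → ℝ) (p : Q × V) : V →L[ℝ] ℝ :=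
  fderiv ℝ (fun η : V => f (p.1, η)) p.2

/-- `c` is a regular value of `∂_η f`. -/
def IsFiberRegularValue (f : Q × V → ℝ) (c : V →L[ℝ] ℝ) : Prop :=
  ∀ p : Q × V, dFiber f p = c →
    Function.Surjective (mfderiv (I.prod 𝓘(ℝ, V)) 𝓘(ℝ, V →L[ℝ] ℝ) (dFiber f) p)

/-- `f : Q × V → ℝ` is a generating family: it is smooth and `0` is a regular value of `∂_η f`. -/
def IsGeneratingFamily (f : Q × V → ℝ) : Prop :=
  ContMDiff (I.prod 𝓘(ℝ, V)) 𝓘(ℝ, ℝ) ∞ f ∧ IsFiberRegularValue I f 0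

/-- The fibre critical set `Σ_f = (∂_η f)⁻¹ (0)`. -/
def fiberCrit (f : Q × V → ℝ) : Set (Q × V) := {p | dFiber f p = 0}

/-- `i_f (x, η) = (x, ∂_x f (x, η)) ∈ T*Q` (to be restricted to `Σ_f`). -/
def iMap (f : Q × V → ℝ) (p : Q × V) : Cotangent I Q :=
  ⟨p.1, (mfderiv I 𝓘(ℝ, ℝ) (fun x : Q => f (x, p.2)) p.1 : TangentSpace I p.1 →L[ℝ] ℝ)⟩

/-- `j_f (x, η) = (x, ∂_x f (x, η), f (x, η)) ∈ J¹Q` (to be restricted to `Σ_f`). -/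
def jMap (f : Q × V → ℝ) (p : Q × V) : OneJet I Q := (iMap I f p, f p)

/-- `f` is a generating family for the Lagrangian `L = i_f (Σ_f)`. -/
def GeneratesLagrangian (f : Q × V → ℝ) (L : Set (Cotangent I Q)) : Prop :=
  IsGeneratingFamily I f ∧ L = iMap I f '' fiberCrit f

/-- `f` is a generating family for the Legendrian `Λ = j_f (Σ_f)`. -/
def GeneratesLegendrian (f : Q × V → ℝ) (Λ : Set (OneJet I Q)) : Prop :=
  IsGeneratingFamily I f ∧ Λ = jMap I f '' fiberCrit f

/-- `f` agrees with the linear function `A (η)` outside a compact subset of `Q × V`. -/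
def AgreesAtInfinity (f : Q × V → ℝ) (A : V →L[ℝ] ℝ) : Prop :=
  ∃ K : Set (Q × V), IsCompact K ∧ ∀ p, p ∉ K → f p = A p.2

/-- `f` is linear-at-infinity. -/
def IsLinearAtInfinity (f : Q × V → ℝ) : Prop :=
  ∃ A : V →L[ℝ] ℝ, A ≠ 0 ∧ AgreesAtInfinity f A

end GeneratingFamilies

section Cobordisms

variable {n N : ℕ} {M : Type*} [TopologicalSpace M] [ChartedSpace (EuclideanSpace ℝ (Fin n)) M]
  [IsManifold (𝓡 n) ∞ M]

/-- The model of `ℝ₊ × M`. -/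
abbrev cylModel (n : ℕ) :
    ModelWithCorners ℝ (ℝ × EuclideanSpace ℝ (Fin n)) (ModelProd ℝ (EuclideanSpace ℝ (Fin n))) :=
  𝓘(ℝ, ℝ).prod (𝓡 n)

/-- The covector `dt` on `ℝ₊ × M`. -/
def dt (q : RPos × M) : TangentSpace (cylModel n) q →L[ℝ] ℝ :=
  mfderiv (cylModel n) 𝓘(ℝ, ℝ) (fun q' : RPos × M => (q'.1 : ℝ)) q

/-- The identification `ℝ × J¹M → T*(ℝ₊ × M)` of the symplectization of `J¹M` with `T*(ℝ₊ × M)`,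
`(s, (x, y, z)) ↦ (e^s, x ; z dt + e^s y)`. -/
def symplToCotangent (a : ℝ × OneJet (𝓡 n) M) : Cotangent (cylModel n) (RPos × M) :=
  let q : RPos × M := (⟨Real.exp a.1, Real.exp_pos a.1⟩, a.2.1.1)
  ⟨q, (a.2.2 • dt q + Real.exp a.1 • (a.2.1.2 : TangentSpace (𝓡 n) a.2.1.1 →L[ℝ] ℝ).comp
    (mfderiv (cylModel n) (𝓡 n) (fun q' : RPos × M => q'.2) q) :
      TangentSpace (cylModel n) q →L[ℝ] ℝ)⟩

/-- The `ℝ₊`-coordinate of a point of `T*(ℝ₊ × M)`. -/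
def tCoord (α : Cotangent (cylModel n) (RPos × M)) : ℝ := (α.1.1 : ℝ)

/-- The set `L ⊆ T*(ℝ₊ × M)` is an immersed Lagrangian cobordism from `Λm` to `Λp`, parametrized by
the immersion `ι` of the submanifold `S ⊆ X`: `L = ι (S)` agrees with the cylinder over `Λm` where
`t ≤ tm` and with the cylinder over `Λp` where `t ≥ tp`, and the part of `S` over `[tm, tp]` is
compact. -/
structure IsImmersedLagrangianCobordism
    {E' : Type*} [NormedAddCommGroup E'] [NormedSpace ℝ E']
    {H' : Type*} [TopologicalSpace H'] (J : ModelWithCorners ℝ E' H')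
    {X : Type*} [TopologicalSpace X] [ChartedSpace H' X]
    (S : Set X) (ι : X → Cotangent (cylModel n) (RPos × M))
    (L : Set (Cotangent (cylModel n) (RPos × M)))
    (Λm Λp : Set (OneJet (𝓡 n) M)) (tm tp : ℝ) : Prop where
  lagrangian : IsLagrangianImmersion J (cylModel n) S ι
  image_eq : L = ι '' S
  tm_pos : 0 < tm
  tm_lt_tp : tm < tp
  lower_end : L ∩ {α | tCoord α ≤ tm} = symplToCotangent '' (Iic (Real.log tm) ×ˢ Λm)
  upper_end : L ∩ {α | tp ≤ tCoord α} = symplToCotangent '' (Ici (Real.log tp) ×ˢ Λp)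
  compact : IsCompact (S ∩ {p | tCoord (ι p) ∈ Icc tm tp})

/-- `(Λm, fm) ≺_{(L, F)} (Λp, fp)`: an immersed gf-compatible Lagrangian cobordism, with a tame
compatible triple of generating families. The immersion parametrizing `L` is `i_F : Σ_F → L`. -/
structure IsImmersedGFCobordism
    (Λm : Set (OneJet (𝓡 n) M)) (fm : M × EuclideanSpace ℝ (Fin N) → ℝ)
    (L : Set (Cotangent (cylModel n) (RPos × M)))
    (F : (RPos × M) × EuclideanSpace ℝ (Fin N) → ℝ)
    (Λp : Set (OneJet (𝓡 n) M)) (fp : M × EuclideanSpace ℝ (Fin N) → ℝ) : Prop where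
  generates_minus : GeneratesLegendrian (𝓡 n) fm Λm
  generates_plus : GeneratesLegendrian (𝓡 n) fp Λp
  generates : GeneratesLagrangian (cylModel n) F L
  linear_minus : IsLinearAtInfinity fm
  linear_plus : IsLinearAtInfinity fp
  slicewise_linear : ∀ t : RPos,
    IsLinearAtInfinity (fun p : M × EuclideanSpace ℝ (Fin N) => F ((t, p.1), p.2))
  compatible_cobordism : ∃ tm tp : ℝ,
    IsImmersedLagrangianCobordism ((cylModel n).prod 𝓘(ℝ, EuclideanSpace ℝ (Fin N)))
      (fiberCrit F) (iMap (cylModel n) F) L Λm Λp tm tp ∧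
    ∀ (t : RPos) (x : M) (η : EuclideanSpace ℝ (Fin N)),
      ((t : ℝ) ≤ tm → F ((t, x), η) = t * fm (x, η)) ∧
      (tp ≤ (t : ℝ) → F ((t, x), η) = t * fp (x, η))

end Cobordisms

end GF

end

/-! Take `ε(t) = t ρ(t) e` with `ρ` a plateau equal to `1` on `[1, 2]` and supported in `[1/2, 3]`,
and `e` a small covector. With `ψ = σ ∂_η f + (1 - σ) A` the fibre derivative is `∂_η F = t (ψ - ρ
e)`, so fibre critical points are solutions of `ψ = ρ(t) e`.

For `t ≤ 1`, `ψ = A` and `‖e‖ < ‖A‖`, so there are none: the lower end is empty. For `1 < t < 2` the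
equation is `ψ = e` with `e` constant; Sard's theorem for `ψ` on `ℝ₊ × M × ℝ^N` supplies an
arbitrarily small regular value `e`. For `t ≥ 2`, `ψ = ∂_η f`, and every small covector is a regular
value of `∂_η f`: zero is one, `∂_η f = A ≠ 0` off a compact set `K`, and regularity is an open
condition. So `ρ(t) e` can be moved to zero, after which `F = t f` and `i_F (Σ_F)` is the cylinder
over `Λ`. Off `K` the slice of `F` is the nonzero linear function `t (A - ρ e)`, which gives
tameness and confines `Σ_F` to `ℝ₊ × K`.

Two general facts carry this: Sard's theorem, obtained here from Hausdorff dimension and Fubini, and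
the fact that `i_F` is a Lagrangian immersion of `Σ_F`, since `i_F^* λ = dF` there and a Hessian is
symmetric. -/

namespace GF

open Module MeasureTheory

/-! ### Submersions in local coordinates -/

section Straightening

variable {E G : Type*} [NormedAddCommGroup E] [NormedSpace ℝ E] [FiniteDimensional ℝ E]
  [NormedAddCommGroup G] [NormedSpace ℝ G] [FiniteDimensional ℝ G]

/-- A smooth map with surjective derivative at `x₀` is the first component of a local
diffeomorphism. -/
theorem exists_straightening {g : E → G} {Ω : Set E} (hΩ : IsOpen Ω) (hg : ContDiffOn ℝ ∞ g Ω)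
    {x₀ : E} (hx₀ : x₀ ∈ Ω) (hsurj : Function.Surjective (fderiv ℝ g x₀)) :
    ∃ Φ : OpenPartialHomeomorph E (G × (fderiv ℝ g x₀).ker),
      x₀ ∈ Φ.source ∧ Φ.source ⊆ Ω ∧ (∀ x, (Φ x).1 = g x) ∧
      ContDiffOn ℝ ∞ Φ Φ.source ∧ ContDiffOn ℝ ∞ Φ.symm Φ.target := by
  have hgat : ∀ x ∈ Ω, ContDiffAt ℝ ∞ g x := fun x hx => hg.contDiffAt (hΩ.mem_nhds hx)
  have hs : HasStrictFDerivAt g (fderiv ℝ g x₀) x₀ :=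
    (hgat x₀ hx₀).hasStrictFDerivAt (by simp)
  have hr : (fderiv ℝ g x₀).range = ⊤ := LinearMap.range_eq_top.2 hsurj
  have hker := (fderiv ℝ g x₀).ker_closedComplemented_of_finiteDimensional_range
  set Ψ := hs.implicitToOpenPartialHomeomorphOfComplemented g (fderiv ℝ g x₀) hr hker with hΨ
  have hΨc : ∀ x ∈ Ω, ContDiffAt ℝ ∞ Ψ x := by
    intro x hx
    have h2 : (Ψ : E → G × (fderiv ℝ g x₀).ker) =
        fun y => (g y, Classical.choose hker (y - x₀)) := rfl
    rw [h2]
    exact (hgat x hx).prodMk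
      ((Classical.choose hker).contDiff.contDiffAt.comp x (by fun_prop))
  have hΨo : ContDiffOn ℝ ∞ Ψ Ω := fun x hx => (hΨc x hx).contDiffWithinAt
  -- The implicit function theorem gives a homeomorphism near `x₀`. Its inverse is smooth wherever
  -- the derivative is invertible, so the source is cut down to the open set of such points.
  set s : Set E := Ω ∩ fderiv ℝ Ψ ⁻¹' range ((↑) : (E ≃L[ℝ] (G × (fderiv ℝ g x₀).ker)) → _) with hsdef
  have hso : IsOpen s :=
    (hΨo.continuousOn_fderiv_of_isOpen hΩ (by simp)).isOpen_inter_preimage hΩ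
      ContinuousLinearEquiv.isOpen
  have hx₀s : x₀ ∈ s := by
    refine ⟨hx₀, ?_⟩
    have := (hs.implicitFunctionDataOfComplemented g (fderiv ℝ g x₀) hr hker).hasStrictFDerivAt
    exact ⟨_, this.hasFDerivAt.fderiv.symm⟩
  refine ⟨Ψ.restrOpen s hso, ?_, ?_, ?_, ?_, ?_⟩
  · exact ⟨hs.mem_implicitToOpenPartialHomeomorphOfComplemented_source hr hker, hx₀s⟩
  · exact fun x hx => hx.2.1
  · intro x; rfl
  · exact fun x hx => (hΨc x hx.2.1).contDiffWithinAt
  · intro y hy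
    have hy1 : y ∈ Ψ.target := by
      have := (Ψ.restrOpen s hso).map_target hy
      have h2 := (Ψ.restrOpen s hso).right_inv hy
      rw [← h2]
      exact Ψ.map_source this.1
    have hy2 : Ψ.symm y ∈ s := ((Ψ.restrOpen s hso).map_target hy).2
    obtain ⟨e, he⟩ := hy2.2
    have hd : HasFDerivAt Ψ (e : E →L[ℝ] _) (Ψ.symm y) := by
      rw [he]; exact ((hΨc _ hy2.1).differentiableAt (by simp)).hasFDerivAt
    exact (Ψ.contDiffAt_symm hy1 hd (hΨc _ hy2.1)).contDiffWithinAt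

end Straightening

/-! ### Taylor estimate at flat points -/

section Taylor

universe u

variable {E : Type u} [NormedAddCommGroup E] [NormedSpace ℝ E]

theorem fderiv_iteratedFDeriv_ne_zero {G : Type*} [NormedAddCommGroup G] [NormedSpace ℝ G]
    {g : E → G} {i : ℕ} {x : E} (h : iteratedFDeriv ℝ (i + 1) g x ≠ 0) :
    fderiv ℝ (iteratedFDeriv ℝ i g) x ≠ 0 := fun h0 =>
  h (by ext; rw [iteratedFDeriv_succ_apply_left, h0]; simp)

/-- A function whose derivatives of order `< k` vanish at `x` is `O(‖y - x‖ ^ k)`, locally uniformly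
in `x`. -/
theorem exists_bound_of_iteratedFDeriv_eq_zero {Ω : Set E} (hΩ : IsOpen Ω) (k : ℕ) :
    ∀ {G : Type u} [NormedAddCommGroup G] [NormedSpace ℝ G] {w : E → G},
      ContDiffOn ℝ ∞ w Ω → ∀ x₀ ∈ Ω, ∃ r > 0, ∃ C ≥ (0 : ℝ), Metric.ball x₀ r ⊆ Ω ∧
        ∀ x ∈ Metric.ball x₀ r, (∀ i < k, iteratedFDeriv ℝ i w x = 0) →
          ∀ y ∈ Metric.ball x₀ r, ‖w y‖ ≤ C * ‖y - x‖ ^ k := by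
  induction k with
  | zero =>
    intro G _ _ w hw x₀ hx₀
    have h1 : ContinuousAt w x₀ := hw.continuousOn.continuousAt (hΩ.mem_nhds hx₀)
    have h2 : ∀ᶠ y in 𝓝 x₀, ‖w y‖ < ‖w x₀‖ + 1 :=
      h1.norm.eventually_lt continuousAt_const (by simp)
    obtain ⟨r, hr, hb⟩ := Metric.eventually_nhds_iff_ball.1 (h2.and (hΩ.mem_nhds hx₀))
    refine ⟨r, hr, ‖w x₀‖ + 1, by positivity, fun y hy => (hb y hy).2, fun x _ _ y hy => ?_⟩
    simpa using (hb y hy).1.le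
  | succ k ih =>
    intro G _ _ w hw x₀ hx₀
    -- The induction passes from `w` to `fderiv ℝ w`, which changes the target space; the mean value
    -- inequality on the segment from `x` then gains one power of `‖y - x‖`.
    obtain ⟨r, hr, C, hC, hsub, hb⟩ :=
      ih (w := fderiv ℝ w) (hw.fderiv_of_isOpen hΩ (by simp)) x₀ hx₀
    refine ⟨r, hr, C, hC, hsub, fun x hx hflat y hy => ?_⟩
    have hwx : w x = 0 := by
      have := hflat 0 (Nat.succ_pos k)
      have h3 := norm_iteratedFDeriv_zero (𝕜 := ℝ) (f := w) (x := x)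
      rw [this, norm_zero] at h3
      exact norm_eq_zero.1 h3.symm
    have hflat' : ∀ i < k, iteratedFDeriv ℝ i (fderiv ℝ w) x = 0 := by
      intro i hi
      rw [← norm_eq_zero, norm_iteratedFDeriv_fderiv, hflat (i + 1) (by omega), norm_zero]
    have hseg : segment ℝ x y ⊆ Metric.ball x₀ r := (convex_ball x₀ r).segment_subset hx hy
    have hbd : ∀ z ∈ segment ℝ x y, ‖fderiv ℝ w z‖ ≤ C * ‖y - x‖ ^ k := by
      intro z hz
      refine (hb x hx hflat' z (hseg hz)).trans ?_
      gcongr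
      rw [segment_eq_image'] at hz
      obtain ⟨θ, hθ, rfl⟩ := hz
      simp only [add_sub_cancel_left, norm_smul, Real.norm_eq_abs, abs_of_nonneg hθ.1]
      exact mul_le_of_le_one_left (norm_nonneg _) hθ.2
    have := (convex_segment x y).norm_image_sub_le_of_norm_fderiv_le (𝕜 := ℝ)
      (fun z hz => (hw.contDiffAt (hΩ.mem_nhds (hsub (hseg hz)))).differentiableAt (by simp))
      hbd (left_mem_segment ℝ x y) (right_mem_segment ℝ x y)
    rw [hwx, sub_zero] at this
    rw [pow_succ, ← mul_assoc]
    exact this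

end Taylor

/-! ### Values at points of vanishing derivative -/

section RankZero

universe u

theorem dimH_image_le_of_locally {X Y : Type*} [MetricSpace X] [SecondCountableTopology X]
    [MetricSpace Y] {f : X → Y} {A : Set X} {d : ENNReal}
    (h : ∀ x ∈ A, ∃ u ∈ 𝓝 x, dimH (f '' (A ∩ u)) ≤ d) : dimH (f '' A) ≤ d := by
  choose! u hu hd using h
  obtain ⟨t, htA, htc, ht⟩ := TopologicalSpace.countable_cover_nhdsWithin
    (f := u) (s := A) fun x hx => mem_nhdsWithin_of_mem_nhds (hu x hx)
  have : f '' A ⊆ ⋃ x ∈ t, f '' (A ∩ u x) := by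
    rintro _ ⟨x, hx, rfl⟩
    obtain ⟨y, hy, hxy⟩ := mem_iUnion₂.1 (ht hx)
    exact mem_iUnion₂.2 ⟨y, hy, x, ⟨hx, hxy⟩, rfl⟩
  refine (dimH_mono this).trans ?_
  rw [dimH_bUnion htc]
  exact iSup₂_le fun x hx => hd x (htA hx)

set_option synthInstance.maxHeartbeats 100000 in
/-- The set of values of a smooth map at points where the derivative vanishes has Hausdorff
dimension zero. -/
theorem dimH_image_of_fderiv_eq_zero (m : ℕ) :
    ∀ {E F : Type u} [NormedAddCommGroup E] [NormedSpace ℝ E] [FiniteDimensional ℝ E]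
      [NormedAddCommGroup F] [NormedSpace ℝ F] {f : E → F} {Ω A : Set E}, finrank ℝ E = m →
      IsOpen Ω → ContDiffOn ℝ ∞ f Ω → A ⊆ Ω → (∀ x ∈ A, fderiv ℝ f x = 0) →
      dimH (f '' A) = 0 := by
  induction m using Nat.strong_induction_on with
  | _ m ih =>
  intro E F _ _ _ _ _ f Ω A hm hΩ hf hA hfA
  -- the points of a hypersurface `w = 0`
  have hyper : ∀ (w : E → ℝ), ContDiffOn ℝ ∞ w Ω → ∀ B ⊆ A, (∀ x ∈ B, w x = 0) →
      ∀ x ∈ B, fderiv ℝ w x ≠ 0 → ∃ u ∈ 𝓝 x, dimH (f '' (B ∩ u)) ≤ 0 := by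
    intro w hw B hB hwB x hx hne
    have hsurj : Function.Surjective (fderiv ℝ w x) :=
      LinearMap.surjective (f := (fderiv ℝ w x).toLinearMap)
        fun h0 => hne (ContinuousLinearMap.coe_injective h0)
    obtain ⟨Φ, hxΦ, hΦΩ, hΦ1, -, hΦs⟩ := exists_straightening hΩ hw (hA (hB hx)) hsurj
    refine ⟨Φ.source, Φ.open_source.mem_nhds hxΦ, ?_⟩
    -- In the straightened coordinates `w = 0` is the slice `{0} × ker`. Restricting `f` to it
    -- lowers the dimension and keeps the derivative zero at points of `B`, so the induction
    -- hypothesis applies.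
    let j : (fderiv ℝ w x).ker → ℝ × (fderiv ℝ w x).ker := fun v => (0, v)
    have hj : ContDiff ℝ ∞ j := contDiff_const.prodMk contDiff_id
    set Ω' : Set (fderiv ℝ w x).ker := j ⁻¹' Φ.target with hΩ'
    have hΩ'o : IsOpen Ω' := Φ.open_target.preimage hj.continuous
    set ψ : (fderiv ℝ w x).ker → E := Φ.symm ∘ j with hψ
    have hψs : ContDiffOn ℝ ∞ ψ Ω' := hΦs.comp hj.contDiffOn fun v hv => hv
    have hψm : MapsTo ψ Ω' Ω := fun v hv => hΦΩ (Φ.map_target hv)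
    have hlt : finrank ℝ (fderiv ℝ w x).ker < m := by
      rw [← hm]
      refine Submodule.finrank_lt fun htop => hne ?_
      ext v
      have : v ∈ (fderiv ℝ w x).ker := by rw [htop]; trivial
      simpa using this
    have key := ih _ hlt (f := f ∘ ψ) (Ω := Ω') (A := Ω' ∩ ψ ⁻¹' B) rfl hΩ'o
      (hf.comp hψs hψm) inter_subset_left (by
        rintro v ⟨hv, hvB⟩
        have hfd : DifferentiableAt ℝ f (ψ v) :=
          (hf.contDiffAt (hΩ.mem_nhds (hψm hv))).differentiableAt (by simp)
        have hψd : DifferentiableAt ℝ ψ v :=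
          (hψs.contDiffAt (hΩ'o.mem_nhds hv)).differentiableAt (by simp)
        rw [fderiv_comp v hfd hψd, hfA _ (hB hvB), ContinuousLinearMap.zero_comp])
    rw [← key]
    refine dimH_mono ?_
    rintro _ ⟨y, ⟨hyB, hyΦ⟩, rfl⟩
    have h1 : j (Φ y).2 = Φ y := Prod.ext ((hwB y hyB).symm.trans (hΦ1 y).symm) rfl
    have h2 : ψ (Φ y).2 = y := by
      simp only [hψ, Function.comp_apply, h1, Φ.left_inv hyΦ]
    refine ⟨(Φ y).2, ⟨?_, ?_⟩, ?_⟩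
    · rw [hΩ', mem_preimage, h1]; exact Φ.map_source hyΦ
    · rw [mem_preimage, h2]; exact hyB
    · simp [h2]
  have hyperG : ∀ {G : Type u} [NormedAddCommGroup G] [NormedSpace ℝ G] {w : E → G},
      ContDiffOn ℝ ∞ w Ω → ∀ B ⊆ A, (∀ x ∈ B, w x = 0) →
      ∀ x ∈ B, fderiv ℝ w x ≠ 0 → ∃ u ∈ 𝓝 x, dimH (f '' (B ∩ u)) ≤ 0 := by
    intro G _ _ w hw B hB hwB x hx hne
    obtain ⟨v, hv⟩ : ∃ v, fderiv ℝ w x v ≠ 0 := by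
      by_contra! h0
      exact hne (ContinuousLinearMap.ext h0)
    -- A functional that detects one nonzero directional derivative reduces a vector-valued `w` to
    -- the scalar case.
    obtain ⟨l, -, hl⟩ := exists_dual_vector ℝ _ (norm_ne_zero_iff.2 hv)
    refine hyper (l ∘ w) (l.contDiff.comp_contDiffOn hw) B hB
      (fun y hy => by simp [hwB y hy]) x hx fun h0 => ?_
    have h1 := (l.hasFDerivAt.comp x
      ((hw.contDiffAt (hΩ.mem_nhds (hA (hB hx)))).differentiableAt (by simp)).hasFDerivAt).fderiv
    rw [h0] at h1
    have h2 := congrArg (fun L => L v) h1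
    simp only [ContinuousLinearMap.comp_apply, hl] at h2
    exact hv (norm_eq_zero.1 (by exact_mod_cast h2.symm))
  -- the points where the first `k` derivatives vanish
  have flat : ∀ k : ℕ, dimH (f '' {x ∈ A | ∀ i ≤ k, iteratedFDeriv ℝ i (fderiv ℝ f) x = 0})
      ≤ m / (k + 2 : ℕ) := by
    intro k
    refine dimH_image_le_of_locally fun x₀ hx₀ => ?_
    obtain ⟨r, hr, C, hC, hsub, hb⟩ := exists_bound_of_iteratedFDeriv_eq_zero hΩ (k + 1)
      (hf.fderiv_of_isOpen hΩ (m := ∞) (by simp)) x₀ (hA hx₀.1)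
    refine ⟨Metric.ball x₀ r, Metric.ball_mem_nhds x₀ hr, ?_⟩
    -- At these points `fderiv ℝ f` is `O(‖y - x‖ ^ (k + 1))`, so `f` is Hölder of exponent `k + 2`,
    -- which divides the dimension by `k + 2`.
    have hold : HolderOnWith C.toNNReal (k + 2 : ℕ) f
        ({x ∈ A | ∀ i ≤ k, iteratedFDeriv ℝ i (fderiv ℝ f) x = 0} ∩ Metric.ball x₀ r) := by
      rintro x ⟨⟨-, hxf⟩, hxr⟩ y ⟨-, hyr⟩
      have hseg : segment ℝ x y ⊆ Metric.ball x₀ r := (convex_ball x₀ r).segment_subset hxr hyr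
      have hbd : ∀ z ∈ segment ℝ x y, ‖fderiv ℝ f z‖ ≤ C * ‖y - x‖ ^ (k + 1) := by
        intro z hz
        refine (hb x hxr (fun i hi => hxf i (by omega)) z (hseg hz)).trans ?_
        gcongr
        rw [segment_eq_image'] at hz
        obtain ⟨θ, hθ, rfl⟩ := hz
        simp only [add_sub_cancel_left, norm_smul, Real.norm_eq_abs, abs_of_nonneg hθ.1]
        exact mul_le_of_le_one_left (norm_nonneg _) hθ.2
      have hmv := (convex_segment x y).norm_image_sub_le_of_norm_fderiv_le (𝕜 := ℝ)
        (fun z hz => (hf.contDiffAt (hΩ.mem_nhds (hsub (hseg hz)))).differentiableAt (by simp))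
        hbd (left_mem_segment ℝ x y) (right_mem_segment ℝ x y)
      rw [mul_assoc, ← pow_succ] at hmv
      rw [edist_comm, edist_comm x y, edist_eq_enorm_sub, edist_eq_enorm_sub,
        ← ofReal_norm, ← ofReal_norm, NNReal.coe_natCast, ENNReal.rpow_natCast,
        ← ENNReal.ofReal_pow (norm_nonneg _)]
      change _ ≤ ENNReal.ofReal C * _
      rw [← ENNReal.ofReal_mul hC]
      exact ENNReal.ofReal_le_ofReal hmv
    refine (hold.dimH_image_le (by positivity)).trans ?_
    have hle : dimH ({x ∈ A | ∀ i ≤ k, iteratedFDeriv ℝ i (fderiv ℝ f) x = 0} ∩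
        Metric.ball x₀ r) ≤ m := by
      refine (dimH_mono (subset_univ _)).trans ?_
      rw [Real.dimH_univ_eq_finrank, hm]
    simp only [ENNReal.coe_natCast]
    gcongr
  -- the intermediate strata
  have strata : ∀ k : ℕ, dimH (f '' (A \ {x ∈ A | ∀ i ≤ k, iteratedFDeriv ℝ i (fderiv ℝ f) x = 0}))
      ≤ 0 := by
    intro k
    set g := fderiv ℝ f with hgdef
    have hg : ContDiffOn ℝ ∞ g Ω := hf.fderiv_of_isOpen hΩ (by simp)
    -- Where the `i`-th derivative of `g` vanishes but the next does not, the point lies on a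
    -- hypersurface cut out by that `i`-th derivative.
    have hT : ∀ i : ℕ, dimH (f '' {x ∈ A | iteratedFDeriv ℝ i g x = 0 ∧
        iteratedFDeriv ℝ (i + 1) g x ≠ 0}) ≤ 0 := by
      intro i
      refine dimH_image_le_of_locally fun x hx => ?_
      have hne := fderiv_iteratedFDeriv_ne_zero hx.2.2
      have hws : ContDiffOn ℝ ∞ (iteratedFDeriv ℝ i g) Ω := fun y hy =>
        ((hg.contDiffAt (hΩ.mem_nhds hy)).iteratedFDeriv_right
          (by exact_mod_cast le_top)).contDiffWithinAt
      obtain ⟨u, hu, hd⟩ := hyperG hws {y ∈ A | iteratedFDeriv ℝ i g y = 0} (fun y hy => hy.1)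
        (fun y hy => hy.2) x ⟨hx.1, hx.2.1⟩ hne
      refine ⟨u, hu, (dimH_mono (image_mono ?_)).trans hd⟩
      exact inter_subset_inter_left _ fun y hy => ⟨hy.1, hy.2.1⟩
    have hsub : A \ {x ∈ A | ∀ i ≤ k, iteratedFDeriv ℝ i g x = 0} ⊆
        ⋃ i : ℕ, {x ∈ A | iteratedFDeriv ℝ i g x = 0 ∧ iteratedFDeriv ℝ (i + 1) g x ≠ 0} := by
      classical
      rintro x ⟨hxA, hx⟩
      have hex : ∃ i, iteratedFDeriv ℝ i g x ≠ 0 := by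
        by_contra! h0
        exact hx ⟨hxA, fun i _ => h0 i⟩
      -- Order zero is excluded because `g = fderiv ℝ f` vanishes on `A`; the first nonvanishing
      -- order is thus a successor `i + 1`.
      have h0 : iteratedFDeriv ℝ 0 g x = 0 := by
        rw [← norm_eq_zero, norm_iteratedFDeriv_zero, hfA x hxA, norm_zero]
      obtain ⟨i, hi⟩ : ∃ i, Nat.find hex = i + 1 := Nat.exists_eq_succ_of_ne_zero fun h =>
        Nat.find_spec hex (by rw [h]; exact h0)
      refine mem_iUnion.2 ⟨i, hxA, ?_, ?_⟩
      · by_contra h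
        have := Nat.find_min' hex h
        omega
      · rw [← hi]; exact Nat.find_spec hex
    refine (dimH_mono (image_mono hsub)).trans ?_
    rw [image_iUnion, dimH_iUnion]
    exact iSup_le hT
  have bound : ∀ k : ℕ, dimH (f '' A) ≤ m / (k + 2 : ℕ) := by
    intro k
    have hsplit : A ⊆ {x ∈ A | ∀ i ≤ k, iteratedFDeriv ℝ i (fderiv ℝ f) x = 0} ∪
        (A \ {x ∈ A | ∀ i ≤ k, iteratedFDeriv ℝ i (fderiv ℝ f) x = 0}) := by
      rw [union_sdiff_self]; exact subset_union_right
    refine (dimH_mono (image_mono hsplit)).trans ?_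
    rw [image_union, dimH_union]
    exact max_le (flat k) ((strata k).trans zero_le)
  -- The bound `m / (k + 2)` holds for all `k`; smoothness of infinite order allows `k → ∞`.
  have h1 : Filter.Tendsto (fun k : ℕ => ((k + 2 : ℕ) : ENNReal)) Filter.atTop (𝓝 ⊤) :=
    ENNReal.tendsto_nat_nhds_top.comp (Filter.tendsto_add_atTop_nat 2)
  have h2 : Filter.Tendsto (fun k : ℕ => (m : ENNReal) / (k + 2 : ℕ)) Filter.atTop (𝓝 0) := by
    simpa using ENNReal.Tendsto.const_div h1 (Or.inr (ENNReal.natCast_ne_top m))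
  exact le_antisymm (ge_of_tendsto' h2 bound) zero_le

end RankZero

/-! ### Sard's theorem in vector spaces -/

section Sard

universe u

theorem measure_image_eq_zero_of_locally {X Y : Type*} [TopologicalSpace X]
    [SecondCountableTopology X] [MeasurableSpace Y] (μ : Measure Y) {f : X → Y} {A : Set X}
    (h : ∀ x ∈ A, ∃ u ∈ 𝓝 x, μ (f '' (A ∩ u)) = 0) : μ (f '' A) = 0 := by
  choose! u hu hd using h
  obtain ⟨t, htA, htc, ht⟩ := TopologicalSpace.countable_cover_nhdsWithin
    (f := u) (s := A) fun x hx => mem_nhdsWithin_of_mem_nhds (hu x hx)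
  have : f '' A ⊆ ⋃ x ∈ t, f '' (A ∩ u x) := by
    rintro _ ⟨x, hx, rfl⟩
    obtain ⟨y, hy, hxy⟩ := mem_iUnion₂.1 (ht hx)
    exact mem_iUnion₂.2 ⟨y, hy, x, ⟨hx, hxy⟩, rfl⟩
  exact measure_mono_null this ((measure_biUnion_null_iff htc).2 fun x hx => hd x (htA hx))

/-- Haar measure is absolutely continuous with respect to Hausdorff measure of dimension `finrank ℝ
F`, which is positive by nontriviality. -/
theorem measure_eq_zero_of_dimH_eq_zero {F : Type*} [NormedAddCommGroup F] [NormedSpace ℝ F]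
    [FiniteDimensional ℝ F] [MeasurableSpace F] [BorelSpace F] [Nontrivial F] (μ : Measure F)
    [μ.IsAddHaarMeasure] {s : Set F} (hs : dimH s = 0) : μ s = 0 := by
  have hpos : 0 < finrank ℝ F := finrank_pos
  refine measure_zero_of_dimH_lt (d := (finrank ℝ F : NNReal)) ?_ (by rw [hs]; exact_mod_cast hpos)
  have : ((finrank ℝ F : NNReal) : ℝ) = finrank ℝ F := by simp
  rw [this]
  exact Measure.absolutelyContinuous_isAddHaarMeasure _ _

variable {E F : Type u} [NormedAddCommGroup E] [NormedSpace ℝ E] [FiniteDimensional ℝ E]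
  [NormedAddCommGroup F] [NormedSpace ℝ F] [FiniteDimensional ℝ F]

/-- If the first component of `L` is `fst` and `L` has rank at most the dimension of the first
factor, then `L` vanishes on the second factor. -/
theorem apply_snd_eq_zero_of_finrank_range_le {R K W : Type*} [AddCommGroup R] [Module ℝ R]
    [FiniteDimensional ℝ R] [AddCommGroup K] [Module ℝ K] [AddCommGroup W] [Module ℝ W]
    [FiniteDimensional ℝ W] (L : R × K →ₗ[ℝ] R × W) (hL : ∀ p, (L p).1 = p.1)
    (hr : finrank ℝ (LinearMap.range L) ≤ finrank ℝ R) (v : K) : (L (0, v)).2 = 0 := by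
  let P : LinearMap.range L →ₗ[ℝ] R := (LinearMap.fst ℝ R W).comp (LinearMap.range L).subtype
  have hP : Function.Surjective P := fun r => ⟨⟨L (r, 0), LinearMap.mem_range_self _ _⟩, hL _⟩
  have heq : finrank ℝ (LinearMap.range L) = finrank ℝ R :=
    le_antisymm hr (LinearMap.finrank_le_finrank_of_surjective hP)
  have hinj := (LinearMap.injective_iff_surjective_of_finrank_eq_finrank heq).2 hP
  have h0 : (⟨L (0, v), LinearMap.mem_range_self _ _⟩ : LinearMap.range L) = 0 :=
    hinj (by rw [map_zero]; exact hL _)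
  have := congrArg (fun z : LinearMap.range L => (z : R × W).2) h0
  simpa using this

/-- Split the target as `R × W`, with `R` the range of the derivative at `x₀`. The `R`-component of
`f` is a submersion near `x₀`, and in coordinates straightening it `f` becomes `(r, v) ↦ (r, h(r,
v))`. Where the rank is still `dim R`, `∂_v h` vanishes, so each slice of the image over `r` has
Hausdorff dimension zero, and Fubini concludes. -/
theorem exists_nhds_measure_image_rank_eq_zero [MeasurableSpace F] [BorelSpace F] (μ : Measure F)
    [μ.IsAddHaarMeasure] {f : E → F} {Ω : Set E} (hΩ : IsOpen Ω) (hf : ContDiffOn ℝ ∞ f Ω)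
    {x₀ : E} (hx₀ : x₀ ∈ Ω) (hns : ¬ Function.Surjective (fderiv ℝ f x₀)) :
    ∃ u ∈ 𝓝 x₀, μ (f '' ({x ∈ Ω | finrank ℝ (fderiv ℝ f x).range =
      finrank ℝ (fderiv ℝ f x₀).range} ∩ u)) = 0 := by
  set R : Submodule ℝ F := (fderiv ℝ f x₀).range with hR
  obtain ⟨W, hW⟩ := R.exists_isCompl
  let e : F ≃L[ℝ] R × W := (R.prodEquivOfIsCompl W hW).symm.toContinuousLinearEquiv
  have heR : ∀ r : R, e r = (r, 0) := fun r => Submodule.prodEquivOfIsCompl_symm_apply_left R W hW r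
  -- Non-surjectivity enters here: Hausdorff dimension zero forces measure zero only in a space of
  -- positive dimension.
  have hWnt : Nontrivial W := by
    rw [Submodule.nontrivial_iff_ne_bot]
    rintro rfl
    have : R = ⊤ := by simpa using hW.sup_eq_top
    exact hns (LinearMap.range_eq_top.1 this)
  have hfat : ∀ x ∈ Ω, DifferentiableAt ℝ f x := fun x hx =>
    (hf.contDiffAt (hΩ.mem_nhds hx)).differentiableAt (by simp)
  set ef : E → R × W := fun x => e (f x) with hef
  have hefs : ContDiffOn ℝ ∞ ef Ω := e.contDiff.comp_contDiffOn hf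
  have hefd : ∀ x ∈ Ω, fderiv ℝ ef x = (e : F →L[ℝ] R × W).comp (fderiv ℝ f x) := fun x hx =>
    (e.toContinuousLinearMap.hasFDerivAt.comp x (hfat x hx).hasFDerivAt).fderiv
  set g : E → R := fun x => (ef x).1 with hg
  have hgs : ContDiffOn ℝ ∞ g Ω := contDiff_fst.comp_contDiffOn hefs
  have hgd : fderiv ℝ g x₀ = (ContinuousLinearMap.fst ℝ R W).comp (fderiv ℝ ef x₀) :=
    (hasFDerivAt_fst.comp x₀ ((hefs.contDiffAt (hΩ.mem_nhds hx₀)).differentiableAt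
      (by simp)).hasFDerivAt).fderiv
  have hgsurj : Function.Surjective (fderiv ℝ g x₀) := by
    rintro ⟨r, v, hv⟩
    refine ⟨v, ?_⟩
    have h1 : fderiv ℝ f x₀ v = ((⟨r, v, hv⟩ : R) : F) := hv
    rw [hgd, hefd x₀ hx₀, ContinuousLinearMap.comp_apply, ContinuousLinearMap.comp_apply, h1]
    exact congrArg Prod.fst (heR _)
  obtain ⟨K, Φ, hxΦ, hΦΩ, hΦ1, -, hΦs⟩ : ∃ (K : Submodule ℝ E)
      (Φ : OpenPartialHomeomorph E (R × K)), x₀ ∈ Φ.source ∧ Φ.source ⊆ Ω ∧ (∀ x, (Φ x).1 = g x) ∧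
      ContDiffOn ℝ ∞ Φ Φ.source ∧ ContDiffOn ℝ ∞ Φ.symm Φ.target :=
    ⟨_, exists_straightening hΩ hgs hx₀ hgsurj⟩
  set T := Φ.target with hT
  have hTo : IsOpen T := Φ.open_target
  have hmap : MapsTo Φ.symm T Ω := fun p hp => hΦΩ (Φ.map_target hp)
  set k : R × K → R × W := ef ∘ Φ.symm with hk
  have hks : ContDiffOn ℝ ∞ k T := hefs.comp hΦs hmap
  have hk1 : ∀ p ∈ T, (k p).1 = p.1 := by
    intro p hp
    have := hΦ1 (Φ.symm p)
    rw [Φ.right_inv hp] at this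
    exact this.symm
  have hkd : ∀ p ∈ T, DifferentiableAt ℝ k p := fun p hp =>
    (hks.contDiffAt (hTo.mem_nhds hp)).differentiableAt (by simp)
  set h : R × K → W := fun p => (k p).2 with hh
  have hhs : ContDiffOn ℝ ∞ h T := contDiff_snd.comp_contDiffOn hks
  have hhd : ∀ p ∈ T, fderiv ℝ h p = (ContinuousLinearMap.snd ℝ R W).comp (fderiv ℝ k p) :=
    fun p hp => (hasFDerivAt_snd.comp p (hkd p hp).hasFDerivAt).fderiv
  have hkfst : ∀ p ∈ T, ∀ q, (fderiv ℝ k p q).1 = q.1 := by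
    intro p hp q
    have h1 := (hasFDerivAt_fst.comp p (hkd p hp).hasFDerivAt).fderiv
    have h2 : (Prod.fst ∘ k) =ᶠ[𝓝 p] Prod.fst := by
      filter_upwards [hTo.mem_nhds hp] with q hq using hk1 q hq
    rw [h2.fderiv_eq, fderiv_fst] at h1
    exact (congrArg (fun L => L q) h1).symm
  set D : R × K → K →L[ℝ] W := fun p => (fderiv ℝ h p).comp (ContinuousLinearMap.inr ℝ R K) with hD
  have hDc : ContinuousOn D T :=
    (hhs.continuousOn_fderiv_of_isOpen hTo (by simp)).clm_comp continuousOn_const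
  have hrank : ∀ x ∈ Φ.source, finrank ℝ (fderiv ℝ f x).range = finrank ℝ R → D (Φ x) = 0 := by
    intro x hx hfr
    have hp : Φ x ∈ T := Φ.map_source hx
    have hxe : Φ.symm (Φ x) = x := Φ.left_inv hx
    have hkx : fderiv ℝ k (Φ x) = ((e : F →L[ℝ] R × W).comp (fderiv ℝ f x)).comp
        (fderiv ℝ Φ.symm (Φ x)) := by
      rw [hk, fderiv_comp _ (by
        rw [hxe]; exact (hefs.contDiffAt (hΩ.mem_nhds (hΦΩ hx))).differentiableAt (by simp))
        ((hΦs.contDiffAt (hTo.mem_nhds hp)).differentiableAt (by simp)), hxe, hefd x (hΦΩ hx)]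
    ext v
    have hle : finrank ℝ (LinearMap.range (fderiv ℝ k (Φ x)).toLinearMap) ≤ finrank ℝ R := by
      rw [← hfr, hkx]
      have h1 : LinearMap.range (((e : F →L[ℝ] R × W).comp (fderiv ℝ f x)).comp
          (fderiv ℝ Φ.symm (Φ x))).toLinearMap ≤
          (fderiv ℝ f x).range.map (e : F →L[ℝ] R × W).toLinearMap := by
        rintro _ ⟨y, rfl⟩
        exact ⟨_, ⟨fderiv ℝ Φ.symm (Φ x) y, rfl⟩, rfl⟩
      exact (Submodule.finrank_mono h1).trans (Submodule.finrank_map_le _ _)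
    have := apply_snd_eq_zero_of_finrank_range_le (fderiv ℝ k (Φ x)).toLinearMap
      (hkfst _ hp) hle v
    simp only [hD, hhd _ hp]
    exact congrArg Subtype.val this
  -- A compact neighbourhood makes the image `S` compact, hence measurable, as Fubini requires.
  obtain ⟨N, hNc, hN0, hNT⟩ := exists_compact_subset hTo (Φ.map_source hxΦ)
  set S : Set (R × W) := k '' (N ∩ D ⁻¹' {0}) with hS
  have hcomp : IsCompact (N ∩ D ⁻¹' {0}) :=
    hNc.of_isClosed_subset ((hDc.mono hNT).preimage_isClosed_of_isClosed hNc.isClosed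
      isClosed_singleton) inter_subset_left
  have hSc : IsCompact S :=
    hcomp.image_of_continuousOn (hks.continuousOn.mono (inter_subset_left.trans hNT))
  refine ⟨Φ.source ∩ Φ ⁻¹' interior N, ?_, ?_⟩
  · exact (Φ.isOpen_inter_preimage isOpen_interior).mem_nhds ⟨hxΦ, hN0⟩
  have hsub : f '' ({x ∈ Ω | finrank ℝ (fderiv ℝ f x).range = finrank ℝ R} ∩
      (Φ.source ∩ Φ ⁻¹' interior N)) ⊆ e ⁻¹' S := by
    rintro _ ⟨x, ⟨⟨-, hxr⟩, hxs, hxN⟩, rfl⟩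
    refine ⟨Φ x, ⟨interior_subset hxN, hrank x hxs hxr⟩, ?_⟩
    simp only [hk, Function.comp_apply, Φ.left_inv hxs, hef]
  refine measure_mono_null hsub ?_
  have := FiniteDimensional.proper_real R
  have := FiniteDimensional.proper_real W
  have hSm : MeasurableSet S := hSc.measurableSet
  have hprod : (Measure.addHaar (G := R)).prod (Measure.addHaar (G := W)) S = 0 := by
    rw [Measure.measure_prod_null hSm]
    refine Filter.Eventually.of_forall fun r => ?_
    have hslice : Prod.mk r ⁻¹' S ⊆
        (fun v => h (r, v)) '' {v : K | (r, v) ∈ T ∧ D (r, v) = 0} := by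
      rintro w ⟨⟨r', v⟩, ⟨hpN, hpD⟩, hpk⟩
      have h1 := hk1 _ (hNT hpN)
      rw [hpk] at h1
      obtain rfl : r = r' := h1
      exact ⟨v, ⟨hNT hpN, hpD⟩, by simp only [hh, hpk]⟩
    have hi : ContDiff ℝ ∞ (fun v : K => (r, v)) := contDiff_const.prodMk contDiff_id
    refine measure_mono_null hslice (measure_eq_zero_of_dimH_eq_zero _
      (dimH_image_of_fderiv_eq_zero _ (Ω := (fun v : K => (r, v)) ⁻¹' T) rfl
        (hTo.preimage hi.continuous) (hhs.comp hi.contDiffOn fun v hv => hv) (fun v hv => hv.1) ?_))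
    rintro v ⟨hvT, hvD⟩
    have h2 : DifferentiableAt ℝ h (r, v) :=
      (hhs.contDiffAt (hTo.mem_nhds hvT)).differentiableAt (by simp)
    have h3 := (h2.hasFDerivAt.comp v (hasFDerivAt_prodMk_right r v)).fderiv
    exact h3.trans hvD
  have hmapm : μ (e ⁻¹' S) = (μ.map e) S := (Measure.map_apply e.continuous.measurable hSm).symm
  rw [hmapm]
  have := e.isAddHaarMeasure_map μ
  exact Measure.absolutelyContinuous_isAddHaarMeasure (μ.map e) _ hprod

/-- **Sard's theorem** for smooth maps between finite-dimensional vector spaces. -/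
theorem measure_image_not_surjective_fderiv_eq_zero [MeasurableSpace F] [BorelSpace F]
    (μ : Measure F) [μ.IsAddHaarMeasure] {f : E → F} {Ω : Set E} (hΩ : IsOpen Ω)
    (hf : ContDiffOn ℝ ∞ f Ω) : μ (f '' {x ∈ Ω | ¬ Function.Surjective (fderiv ℝ f x)}) = 0 := by
  have := FiniteDimensional.proper_real E
  -- The critical set is a countable union of strata of constant rank, and the local statement
  -- treats points whose rank equals that of the centre.
  have hr : ∀ r : ℕ, μ (f '' {x ∈ Ω | ¬ Function.Surjective (fderiv ℝ f x) ∧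
      finrank ℝ (fderiv ℝ f x).range = r}) = 0 := by
    intro r
    refine measure_image_eq_zero_of_locally μ fun x hx => ?_
    obtain ⟨u, hu, h0⟩ := exists_nhds_measure_image_rank_eq_zero μ hΩ hf hx.1 hx.2.1
    refine ⟨u, hu, measure_mono_null (image_mono ?_) h0⟩
    exact inter_subset_inter_left _ fun y hy => ⟨hy.1, hy.2.2.trans hx.2.2.symm⟩
  have hsub : {x ∈ Ω | ¬ Function.Surjective (fderiv ℝ f x)} ⊆ ⋃ r : ℕ,
      {x ∈ Ω | ¬ Function.Surjective (fderiv ℝ f x) ∧ finrank ℝ (fderiv ℝ f x).range = r} :=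
    fun x hx => mem_iUnion.2 ⟨_, hx.1, hx.2, rfl⟩
  refine measure_mono_null (image_mono hsub) ?_
  rw [image_iUnion]
  exact measure_iUnion_null hr

end Sard

/-! ### Fibre derivatives and `i_F` in charts -/

section FiberChart

variable {E : Type*} [NormedAddCommGroup E] [NormedSpace ℝ E]
  {H : Type*} [TopologicalSpace H] (I : ModelWithCorners ℝ E H) [I.Boundaryless]
  {Q : Type*} [TopologicalSpace Q] [ChartedSpace H Q]
  (V : Type*) [NormedAddCommGroup V]

/-- The chart of `Q × V` given by a chart of `Q` and the identity of `V`. -/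
noncomputable def fiberChart (q₀ : Q) : OpenPartialHomeomorph (Q × V) (E × V) :=
  ((chartAt H q₀).trans I.toHomeomorph.toOpenPartialHomeomorph).prod (OpenPartialHomeomorph.refl V)

variable {V}

theorem mem_fiberChart_source {q₀ : Q} {p : Q × V} :
    p ∈ (fiberChart I V q₀).source ↔ p.1 ∈ (chartAt H q₀).source := by
  simp [fiberChart]

theorem mem_fiberChart_target {q₀ : Q} {p : E × V} :
    p ∈ (fiberChart I V q₀).target ↔ p.1 ∈ (extChartAt I q₀).target := by
  have h1 : p.1 ∈ ((chartAt H q₀).trans I.toHomeomorph.toOpenPartialHomeomorph).target ↔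
      p.1 ∈ (extChartAt I q₀).target := by
    rw [extChartAt_target, I.range_eq_univ, inter_univ]
    simp [ModelWithCorners.toHomeomorph]
  rw [← h1]
  simp [fiberChart]

theorem mem_fiberChart_source_self (p : Q × V) : p ∈ (fiberChart I V p.1).source :=
  (mem_fiberChart_source I).2 (mem_chart_source H p.1)

variable [NormedSpace ℝ V]

theorem dFiber_eventuallyEq {F : Q × V → ℝ} {q₀ : Q} {p : Q × V}
    (hp : p ∈ (fiberChart I V q₀).source) :
    dFiber F =ᶠ[𝓝 p] (dFiber F ∘ (fiberChart I V q₀).symm) ∘ fiberChart I V q₀ := by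
  filter_upwards [(fiberChart I V q₀).open_source.mem_nhds hp] with p' hp'
  simp only [Function.comp_apply, (fiberChart I V q₀).left_inv hp']

variable [IsManifold I ∞ Q]

theorem contMDiffAt_fiberChart {q₀ : Q} {p : Q × V} (hp : p ∈ (fiberChart I V q₀).source) :
    ContMDiffAt (I.prod 𝓘(ℝ, V)) 𝓘(ℝ, E × V) ∞ (fiberChart I V q₀) p := by
  have h1 : ContMDiffAt I 𝓘(ℝ, E) ∞ (extChartAt I q₀) p.1 :=
    contMDiffAt_extChartAt' ((mem_fiberChart_source I).1 hp)
  exact (h1.comp p contMDiffAt_fst).prodMk_space contMDiffAt_snd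

theorem contMDiffAt_fiberChart_symm {q₀ : Q} {p : E × V} (hp : p ∈ (fiberChart I V q₀).target) :
    ContMDiffAt 𝓘(ℝ, E × V) (I.prod 𝓘(ℝ, V)) ∞ (fiberChart I V q₀).symm p := by
  have h1 : ContMDiffAt 𝓘(ℝ, E) I ∞ (extChartAt I q₀).symm p.1 :=
    (contMDiffOn_extChartAt_symm q₀).contMDiffAt
      ((isOpen_extChartAt_target q₀).mem_nhds ((mem_fiberChart_target I).1 hp))
  have h2 : ContMDiffAt 𝓘(ℝ, E × V) 𝓘(ℝ, E) ∞ (Prod.fst : E × V → E) p :=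
    contDiffAt_fst.contMDiffAt
  have h3 : ContMDiffAt 𝓘(ℝ, E × V) 𝓘(ℝ, V) ∞ (Prod.snd : E × V → V) p :=
    contDiffAt_snd.contMDiffAt
  exact (h1.comp p h2).prodMk h3

/-- A function on `Q × V`, read in a chart of `Q`. -/
noncomputable def fiberLocal (F : Q × V → ℝ) (q₀ : Q) : E × V → ℝ := F ∘ (fiberChart I V q₀).symm

variable {I} {F : Q × V → ℝ}

theorem contDiffOn_fiberLocal (hF : ContMDiff (I.prod 𝓘(ℝ, V)) 𝓘(ℝ, ℝ) ∞ F)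
    (q₀ : Q) :
    ContDiffOn ℝ ∞ (fiberLocal I F q₀) (fiberChart I V q₀).target := fun p hp =>
  ((hF.contMDiffAt.comp p (contMDiffAt_fiberChart_symm I hp)).contDiffAt).contDiffWithinAt

theorem differentiableAt_fiberLocal (hF : ContMDiff (I.prod 𝓘(ℝ, V)) 𝓘(ℝ, ℝ) ∞ F)
    {q₀ : Q} {p : E × V} (hp : p ∈ (fiberChart I V q₀).target) :
    DifferentiableAt ℝ (fiberLocal I F q₀) p :=
  ((contDiffOn_fiberLocal hF q₀).contDiffAt
    ((fiberChart I V q₀).open_target.mem_nhds hp)).differentiableAt (by simp)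

theorem dFiber_fiberChart_symm (hF : ContMDiff (I.prod 𝓘(ℝ, V)) 𝓘(ℝ, ℝ) ∞ F)
    {q₀ : Q} {p : E × V} (hp : p ∈ (fiberChart I V q₀).target) :
    dFiber F ((fiberChart I V q₀).symm p) =
      (fderiv ℝ (fiberLocal I F q₀) p).comp (ContinuousLinearMap.inr ℝ E V) :=
  (HasFDerivAt.comp (f := fun η => (p.1, η)) p.2 (differentiableAt_fiberLocal hF hp).hasFDerivAt
    (hasFDerivAt_prodMk_right p.1 p.2)).fderiv

theorem contDiffOn_dFiber_fiberChart_symm (hF : ContMDiff (I.prod 𝓘(ℝ, V)) 𝓘(ℝ, ℝ) ∞ F)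
    (q₀ : Q) :
    ContDiffOn ℝ ∞ (dFiber F ∘ (fiberChart I V q₀).symm) (fiberChart I V q₀).target := by
  refine ContDiffOn.congr ?_ fun p hp => dFiber_fiberChart_symm hF hp
  exact ((contDiffOn_fiberLocal hF q₀).fderiv_of_isOpen (fiberChart I V q₀).open_target
    (m := ∞) (by simp)).clm_comp contDiffOn_const

theorem contMDiff_dFiber (hF : ContMDiff (I.prod 𝓘(ℝ, V)) 𝓘(ℝ, ℝ) ∞ F) :
    ContMDiff (I.prod 𝓘(ℝ, V)) 𝓘(ℝ, V →L[ℝ] ℝ) ∞ (dFiber F) := by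
  intro p
  have hp := mem_fiberChart_source_self I p
  refine ContMDiffAt.congr_of_eventuallyEq ?_ (dFiber_eventuallyEq I hp)
  have h1 := (contDiffOn_dFiber_fiberChart_symm hF p.1).contDiffAt
    ((fiberChart I V p.1).open_target.mem_nhds ((fiberChart I V p.1).map_source hp))
  exact h1.contMDiffAt.comp p (contMDiffAt_fiberChart I hp)

theorem surjective_fderiv_dFiber_fiberChart_symm (hF : ContMDiff (I.prod 𝓘(ℝ, V)) 𝓘(ℝ, ℝ) ∞ F)
    {q₀ : Q} {p : Q × V}
    (hp : p ∈ (fiberChart I V q₀).source)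
    (hs : Function.Surjective (mfderiv (I.prod 𝓘(ℝ, V)) 𝓘(ℝ, V →L[ℝ] ℝ) (dFiber F) p)) :
    Function.Surjective (fderiv ℝ (dFiber F ∘ (fiberChart I V q₀).symm) (fiberChart I V q₀ p)) := by
  have h1 := (contDiffOn_dFiber_fiberChart_symm hF q₀).contDiffAt
    ((fiberChart I V q₀).open_target.mem_nhds ((fiberChart I V q₀).map_source hp))
  have h2 := (contMDiffAt_fiberChart I hp).mdifferentiableAt (by simp)
  rw [(dFiber_eventuallyEq I hp).mfderiv_eq,
    mfderiv_comp p (h1.contMDiffAt.mdifferentiableAt (by simp)) h2, mfderiv_eq_fderiv] at hs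
  exact Function.Surjective.of_comp hs

/-- In a chart of `Q` the covector part of `i_F` is the partial derivative `∂_x` of the local
expression of `F`. This reduces smoothness and immersivity of `i_F` to calculus on `E × V`. -/
theorem trivializationAt_iMap (hF : ContMDiff (I.prod 𝓘(ℝ, V)) 𝓘(ℝ, ℝ) ∞ F)
    {q₀ : Q} {p : Q × V} (hp : p ∈ (fiberChart I V q₀).source) :
    (trivializationAt (E →L[ℝ] ℝ) (fun q : Q => TangentSpace I q →L[ℝ] ℝ) q₀ (iMap I F p)).2 =
      (fderiv ℝ (fiberLocal I F q₀) (fiberChart I V q₀ p)).comp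
        (ContinuousLinearMap.inl ℝ E V) := by
  have hpc := (mem_fiberChart_source I).1 hp
  have hpt := (fiberChart I V q₀).map_source hp
  have hq : (extChartAt I q₀).symm (extChartAt I q₀ p.1) = p.1 :=
    (extChartAt I q₀).left_inv (by simpa using hpc)
  have h1 := (HasFDerivAt.comp (f := fun y => (y, p.2)) (extChartAt I q₀ p.1)
    (differentiableAt_fiberLocal hF hpt).hasFDerivAt
    (hasFDerivAt_prodMk_left (extChartAt I q₀ p.1) p.2)).fderiv
  refine Eq.trans ?_ h1
  have h2 : fiberLocal I F q₀ ∘ (fun y => (y, p.2)) =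
    (fun x : Q => F (x, p.2)) ∘ (extChartAt I q₀).symm := rfl
  have h3 : MDifferentiableAt I 𝓘(ℝ, ℝ) (fun x : Q => F (x, p.2)) p.1 :=
    ((hF.contMDiffAt (x := p)).comp p.1 (contMDiffAt_id.prodMk contMDiffAt_const)).mdifferentiableAt
      (by simp)
  have h4 : MDifferentiableAt 𝓘(ℝ, E) I (extChartAt I q₀).symm (extChartAt I q₀ p.1) :=
    ((contMDiffOn_extChartAt_symm (n := ∞) q₀).contMDiffAt ((isOpen_extChartAt_target q₀).mem_nhds
      ((mem_fiberChart_target I).1 hpt))).mdifferentiableAt (by simp)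
  -- The trivialization of `T*Q` is precomposition with the inverse trivialization of `TQ`, which is
  -- the derivative of the inverse chart.
  have h5 : (trivializationAt E (TangentSpace I) q₀).symmL ℝ p.1 =
      mfderiv 𝓘(ℝ, E) I (extChartAt I q₀).symm (extChartAt I q₀ p.1) := by
    rw [TangentBundle.symmL_trivializationAt hpc, I.range_eq_univ, mfderivWithin_univ]
  refine ContinuousLinearMap.ext fun v => ?_
  have h6 : fderiv ℝ ((fun x : Q => F (x, p.2)) ∘ (extChartAt I q₀).symm) (extChartAt I q₀ p.1) v =
      (mfderiv I 𝓘(ℝ, ℝ) (fun x : Q => F (x, p.2)) p.1 : E →L[ℝ] ℝ)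
        (mfderiv 𝓘(ℝ, E) I (extChartAt I q₀).symm (extChartAt I q₀ p.1) v) := by
    rw [← mfderiv_eq_fderiv]
    exact mfderiv_comp_apply_of_eq (extChartAt I q₀ p.1) h3 h4 hq v
  rw [h2]
  refine Eq.trans ?_ h6.symm
  rw [← h5, hom_trivializationAt_apply]
  simp only [ContinuousLinearMap.inCoordinates]
  rw [ContinuousLinearMap.comp_apply]
  exact congrArg (fun L : ℝ →L[ℝ] ℝ => L _) (Bundle.Trivial.continuousLinearMapAt_trivialization ℝ Q ℝ p.1)

end FiberChart

/-! ### Chain rule lemmas -/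

section Derivatives

variable {E : Type*} [NormedAddCommGroup E] [NormedSpace ℝ E]
  {G : Type*} [NormedAddCommGroup G] [NormedSpace ℝ G]
  {E' : Type*} [NormedAddCommGroup E'] [NormedSpace ℝ E']
  {H' : Type*} [TopologicalSpace H'] {J : ModelWithCorners ℝ E' H'}
  {X : Type*} [TopologicalSpace X] [ChartedSpace H' X]

theorem fderiv_comp_apply_eq_zero {ψ : E → X} {g : X → G} {u w : E}
    (hg : MDifferentiableAt J 𝓘(ℝ, G) g (ψ u)) (hψ : MDifferentiableAt 𝓘(ℝ, E) J ψ u)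
    (hw : mfderiv 𝓘(ℝ, E) J ψ u w = 0) : fderiv ℝ (g ∘ ψ) u w = 0 := by
  have h := mfderiv_comp_apply u hg hψ w
  rw [hw] at h
  rw [← mfderiv_eq_fderiv]
  exact h.trans (map_zero (mfderiv J 𝓘(ℝ, G) g (ψ u)))

theorem injective_mfderiv_of_forall {ψ : E → X} {u : E}
    (h : ∀ w : E, mfderiv 𝓘(ℝ, E) J ψ u w = 0 → w = 0) :
    Function.Injective (mfderiv 𝓘(ℝ, E) J ψ u) :=
  (injective_iff_map_eq_zero (mfderiv 𝓘(ℝ, E) J ψ u)).2 h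

theorem fderiv_clm_comp_const_apply {Y Z : Type*} [NormedAddCommGroup Y] [NormedSpace ℝ Y]
    [NormedAddCommGroup Z] [NormedSpace ℝ Z] {A : E → Y →L[ℝ] G} {x : E}
    (hA : DifferentiableAt ℝ A x) (T : Z →L[ℝ] Y) (v : E) :
    fderiv ℝ (fun z => (A z).comp T) x v = (fderiv ℝ A x v).comp T := by
  rw [fderiv_clm_comp hA (differentiableAt_const T)]
  simp

end Derivatives

/-! ### `i_F` is a Lagrangian immersion of `Σ_F` -/

section Lagrangian

variable {E : Type*} [NormedAddCommGroup E] [NormedSpace ℝ E]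
  {H : Type*} [TopologicalSpace H] {I : ModelWithCorners ℝ E H} [I.Boundaryless]
  {Q : Type*} [TopologicalSpace Q] [ChartedSpace H Q] [IsManifold I ∞ Q]
  {V : Type*} [NormedAddCommGroup V] [NormedSpace ℝ V] {F : Q × V → ℝ}

theorem contMDiff_iMap (hF : ContMDiff (I.prod 𝓘(ℝ, V)) 𝓘(ℝ, ℝ) ∞ F) :
    ContMDiff (I.prod 𝓘(ℝ, V)) (cotModel I) ∞ (iMap I F) := by
  intro p
  refine contMDiffAt_totalSpace.2 ⟨contMDiffAt_fst, ?_⟩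
  have hp := mem_fiberChart_source_self I p
  have h1 : ContDiffAt ℝ ∞ (fun z => (fderiv ℝ (fiberLocal I F p.1) z).comp
      (ContinuousLinearMap.inl ℝ E V)) (fiberChart I V p.1 p) :=
    (((contDiffOn_fiberLocal hF p.1).contDiffAt ((fiberChart I V p.1).open_target.mem_nhds
      ((fiberChart I V p.1).map_source hp))).fderiv_right (m := ∞) (by simp)).clm_comp
      contDiffAt_const
  refine (h1.contMDiffAt.comp p (contMDiffAt_fiberChart I hp)).congr_of_eventuallyEq ?_
  filter_upwards [(fiberChart I V p.1).open_source.mem_nhds hp] with p' hp'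
  exact trivializationAt_iMap hF hp'

/-- The regular value theorem: straightening `∂_η F` turns `Σ_F` into the slice `{0} × K`, with `K`
the kernel of its derivative. -/
theorem isEmbeddedSubmanifold_fiberCrit [FiniteDimensional ℝ E] [FiniteDimensional ℝ V]
    (hF : IsGeneratingFamily I F) :
    IsEmbeddedSubmanifold E (I.prod 𝓘(ℝ, V)) (fiberCrit F) := by
  intro p hp
  have hps := mem_fiberChart_source_self I p
  set C := fiberChart I V p.1 with hC
  have hsurj := surjective_fderiv_dFiber_fiberChart_symm hF.1 hps (hF.2 p hp)
  set G := dFiber F ∘ C.symm with hG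
  have hGs : ContDiffOn ℝ ∞ G C.target := contDiffOn_dFiber_fiberChart_symm hF.1 p.1
  obtain ⟨K, hK, Φ, hpΦ, hΦC, hΦ1, hΦs, hΦs'⟩ : ∃ K : Submodule ℝ (E × V),
      K = (fderiv ℝ G (C p)).ker ∧ ∃ Φ : OpenPartialHomeomorph (E × V) ((V →L[ℝ] ℝ) × K),
      C p ∈ Φ.source ∧ Φ.source ⊆ C.target ∧ (∀ x, (Φ x).1 = G x) ∧
      ContDiffOn ℝ ∞ Φ Φ.source ∧ ContDiffOn ℝ ∞ Φ.symm Φ.target :=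
    ⟨_, rfl, exists_straightening C.open_target hGs (C.map_source hps) hsurj⟩
  -- Since `dim V* = dim V`, the kernel has the dimension of `Q`, so `E` itself can serve as
  -- parameter space.
  have hdim : finrank ℝ E = finrank ℝ K := by
    have h1 := (fderiv ℝ G (C p)).toLinearMap.finrank_range_add_finrank_ker
    rw [LinearMap.range_eq_top.2 hsurj, finrank_top, finrank_prod,
      (LinearMap.toContinuousLinearMap (𝕜 := ℝ) (E := V) (F' := ℝ)).symm.finrank_eq,
      Subspace.dual_finrank_eq] at h1
    rw [hK]
    omega
  let κ : E ≃L[ℝ] K := ContinuousLinearEquiv.ofFinrankEq hdim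
  set Θ := C.trans Φ with hΘ
  let j : E → (V →L[ℝ] ℝ) × K := fun u => (0, κ u)
  have hj : ContDiff ℝ ∞ j := contDiff_const.prodMk κ.contDiff
  have hjemb : IsEmbedding j := (isEmbedding_prodMkRight 0).comp κ.toHomeomorph.isEmbedding
  have hΘt : ∀ y ∈ Θ.target, y ∈ Φ.target ∧ Φ.symm y ∈ C.target := by
    intro y hy
    rw [hΘ, OpenPartialHomeomorph.trans_target] at hy
    exact hy
  have hΘsm : ∀ y ∈ Θ.target, ContMDiffAt 𝓘(ℝ, (V →L[ℝ] ℝ) × K) (I.prod 𝓘(ℝ, V)) ∞ Θ.symm y :=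
    fun y hy => (contMDiffAt_fiberChart_symm I (hΘt y hy).2).comp y
      (hΦs'.contDiffAt (Φ.open_target.mem_nhds (hΘt y hy).1)).contMDiffAt
  have hΘm : ∀ x ∈ Θ.source, ContMDiffAt (I.prod 𝓘(ℝ, V)) 𝓘(ℝ, (V →L[ℝ] ℝ) × K) ∞ Θ x := by
    intro x hx
    rw [hΘ, OpenPartialHomeomorph.trans_source] at hx
    exact (hΦs.contDiffAt (Φ.open_source.mem_nhds hx.2)).contMDiffAt.comp x
      (contMDiffAt_fiberChart I hx.1)
  have hΘ1 : ∀ x ∈ Θ.source, (Θ x).1 = dFiber F x := by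
    intro x hx
    rw [hΘ, OpenPartialHomeomorph.trans_source] at hx
    exact (hΦ1 (C x)).trans (congrArg (dFiber F) (C.left_inv hx.1))
  have hUo : IsOpen (j ⁻¹' Θ.target) := Θ.open_target.preimage hj.continuous
  have hφs : ∀ u ∈ j ⁻¹' Θ.target, ContMDiffAt 𝓘(ℝ, E) (I.prod 𝓘(ℝ, V)) ∞ (Θ.symm ∘ j) u :=
    fun u hu => (hΘsm _ hu).comp u hj.contDiffAt.contMDiffAt
  have himg : (Θ.symm ∘ j) '' (j ⁻¹' Θ.target) = fiberCrit F ∩ Θ.source := by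
    ext x
    constructor
    · rintro ⟨u, hu, rfl⟩
      have hx := Θ.map_target hu
      refine ⟨?_, hx⟩
      have h1 := hΘ1 _ hx
      rw [Θ.right_inv hu] at h1
      exact h1.symm
    · rintro ⟨hx0, hx⟩
      have h1 : j (κ.symm (Θ x).2) = Θ x :=
        Prod.ext ((hΘ1 x hx).trans hx0).symm (κ.apply_symm_apply _)
      refine ⟨κ.symm (Θ x).2, ?_, ?_⟩
      · rw [mem_preimage, h1]; exact Θ.map_source hx
      · rw [Function.comp_apply, h1, Θ.left_inv hx]
  refine ⟨j ⁻¹' Θ.target, Θ.symm ∘ j, ⟨hUo, fun u hu => (hφs u hu).contMDiffWithinAt, ?_, ?_,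
    Θ.source, Θ.open_source, himg⟩, ?_⟩
  · intro u hu
    have h1 : (Θ ∘ (Θ.symm ∘ j)) =ᶠ[𝓝 u] j := by
      filter_upwards [hUo.mem_nhds hu] with u' hu' using Θ.right_inv hu'
    have h2 := mfderiv_comp u ((hΘm _ (Θ.map_target hu)).mdifferentiableAt (by simp))
      ((hφs u hu).mdifferentiableAt (by simp))
    rw [h1.mfderiv_eq, mfderiv_eq_fderiv] at h2
    have h3 : HasFDerivAt j ((0 : E →L[ℝ] (V →L[ℝ] ℝ)).prod (κ : E →L[ℝ] K)) u :=
      (hasFDerivAt_const _ _).prodMk κ.hasFDerivAt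
    rw [h3.fderiv] at h2
    have h4 : Function.Injective ((0 : E →L[ℝ] (V →L[ℝ] ℝ)).prod (κ : E →L[ℝ] K)) :=
      fun v w hvw => κ.injective (congrArg Prod.snd hvw)
    rw [h2] at h4
    exact Function.Injective.of_comp h4
  · let jr : j ⁻¹' Θ.target → Θ.target := fun u => ⟨j u, u.2⟩
    have hjr : IsEmbedding jr :=
      IsEmbedding.of_comp (hj.continuous.comp continuous_subtype_val |>.subtype_mk _)
        continuous_subtype_val (hjemb.comp IsEmbedding.subtypeVal)
    exact IsEmbedding.subtypeVal.comp (Θ.toHomeomorphSourceTarget.symm.isEmbedding.comp hjr)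
  · rw [himg]
    refine ⟨hp, ?_⟩
    rw [hΘ, OpenPartialHomeomorph.trans_source]
    exact ⟨hps, hpΦ⟩

/-- The pullback of the Liouville form by `i_F` is `dF` along the fibre critical set. -/
theorem pullbackLiouville_iMap (hF : ContMDiff (I.prod 𝓘(ℝ, V)) 𝓘(ℝ, ℝ) ∞ F) {φ : E → Q × V}
    {u : E} (hφ : ContMDiffAt 𝓘(ℝ, E) (I.prod 𝓘(ℝ, V)) ∞ φ u) (hu : φ u ∈ fiberCrit F) :
    pullbackLiouville I (iMap I F ∘ φ) u = fderiv ℝ (F ∘ φ) u := by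
  have hφd : MDifferentiableAt 𝓘(ℝ, E) (I.prod 𝓘(ℝ, V)) φ u := hφ.mdifferentiableAt (by simp)
  have hψd : MDifferentiableAt 𝓘(ℝ, E) (cotModel I) (iMap I F ∘ φ) u :=
    ((contMDiff_iMap hF).contMDiffAt.comp u hφ).mdifferentiableAt (by simp)
  have hπ : MDifferentiableAt (cotModel I) I (fun β : Cotangent I Q => β.1) (iMap I F (φ u)) :=
    (contMDiffAt_proj (fun q : Q => TangentSpace I q →L[ℝ] ℝ) (n := 1)).mdifferentiableAt (by simp)
  have hFd : MDifferentiableAt (I.prod 𝓘(ℝ, V)) 𝓘(ℝ, ℝ) F (φ u) :=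
    hF.contMDiffAt.mdifferentiableAt (by simp)
  ext w
  have h1 := mfderiv_comp_apply u hπ hψd w
  have h2 := mfderiv_comp_apply u (mdifferentiableAt_fst (I := I) (I' := 𝓘(ℝ, V)) (x := φ u)) hφd w
  rw [mfderiv_fst] at h2
  have h3 : mfderiv (cotModel I) I (fun β : Cotangent I Q => β.1) (iMap I F (φ u))
      (mfderiv 𝓘(ℝ, E) (cotModel I) (iMap I F ∘ φ) u w) =
      (mfderiv 𝓘(ℝ, E) (I.prod 𝓘(ℝ, V)) φ u w).1 := h1.symm.trans h2
  have h4 := mfderiv_comp_apply u hFd hφd w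
  rw [mfderiv_prod_eq_add_apply hFd] at h4
  -- On `Σ_F` the fibre part of `dF` vanishes; what remains is `∂_x F` applied to the base
  -- component, which is the Liouville form.
  have h5 : (mfderiv 𝓘(ℝ, V) 𝓘(ℝ, ℝ) (fun η => F ((φ u).1, η)) (φ u).2 : V →L[ℝ] ℝ) = 0 := by
    rw [mfderiv_eq_fderiv]; exact hu
  have h6 : fderiv ℝ (F ∘ φ) u w = mfderiv I 𝓘(ℝ, ℝ) (fun x => F (x, (φ u).2)) (φ u).1
      (mfderiv 𝓘(ℝ, E) (I.prod 𝓘(ℝ, V)) φ u w).1 := by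
    rw [← mfderiv_eq_fderiv]
    refine h4.trans ?_
    erw [h5]
    exact add_zero _
  rw [h6, ← h3]
  rfl

/-- Let `ζ` be tangent to `Σ_F` and killed by the differential of `i_F`. In a chart its base
component is zero and the Hessian of `F` annihilates it: the `x`-part by assumption, the `η`-part by
tangency. By symmetry `ζ` pairs to zero with the image of the derivative of `∂_η F`, which is all of
`V*`, so its fibre component is zero too. -/
theorem injective_mfderiv_iMap (hF : IsGeneratingFamily I F) {φ : E → Q × V} {U : Set E}
    (hU : IsOpen U) (hφ : ContMDiffOn 𝓘(ℝ, E) (I.prod 𝓘(ℝ, V)) ∞ φ U)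
    (hφF : ∀ u ∈ U, φ u ∈ fiberCrit F) {u : E} (hu : u ∈ U)
    (hinj : Function.Injective (mfderiv 𝓘(ℝ, E) (I.prod 𝓘(ℝ, V)) φ u)) :
    Function.Injective (mfderiv 𝓘(ℝ, E) (cotModel I) (iMap I F ∘ φ) u) := by
  have hp := mem_fiberChart_source_self I (φ u)
  set C := fiberChart I V (φ u).1 with hC
  set L := fiberLocal I F (φ u).1 with hL
  have hLs : ContDiffOn ℝ ∞ L C.target := contDiffOn_fiberLocal hF.1 _
  have hpt : C (φ u) ∈ C.target := C.map_source hp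
  have hLat : ContDiffAt ℝ ∞ L (C (φ u)) := hLs.contDiffAt (C.open_target.mem_nhds hpt)
  have hDL : DifferentiableAt ℝ (fderiv ℝ L) (C (φ u)) :=
    (hLat.fderiv_right (m := ∞) (by simp)).differentiableAt (by simp)
  have hφu : ContMDiffAt 𝓘(ℝ, E) (I.prod 𝓘(ℝ, V)) ∞ φ u := hφ.contMDiffAt (hU.mem_nhds hu)
  have hφd : MDifferentiableAt 𝓘(ℝ, E) (I.prod 𝓘(ℝ, V)) φ u := hφu.mdifferentiableAt (by simp)
  have hψs : ContMDiffAt 𝓘(ℝ, E) (cotModel I) ∞ (iMap I F ∘ φ) u :=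
    (contMDiff_iMap hF.1).contMDiffAt.comp u hφu
  have hψd := hψs.mdifferentiableAt (by simp)
  have hCm : MDifferentiableAt (I.prod 𝓘(ℝ, V)) 𝓘(ℝ, E × V) C (φ u) :=
    (contMDiffAt_fiberChart I hp).mdifferentiableAt (by simp)
  have hCφ : DifferentiableAt ℝ (C ∘ φ) u :=
    ((contMDiffAt_fiberChart I hp).comp u hφu).contDiffAt.differentiableAt (by simp)
  have hnear : ∀ᶠ u' in 𝓝 u, u' ∈ U ∧ φ u' ∈ C.source :=
    Filter.Eventually.and (hU.mem_nhds hu) (hφd.continuousAt (C.open_source.mem_nhds hp))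
  have hCinj : Function.Injective (mfderiv (I.prod 𝓘(ℝ, V)) 𝓘(ℝ, E × V) C (φ u)) := by
    have h1 : (C.symm ∘ C) =ᶠ[𝓝 (φ u)] id := by
      filter_upwards [C.open_source.mem_nhds hp] with x hx using C.left_inv hx
    have h2 := mfderiv_comp (φ u)
      ((contMDiffAt_fiberChart_symm I hpt).mdifferentiableAt (by simp)) hCm
    rw [h1.mfderiv_eq, mfderiv_id] at h2
    have h3 : Function.Injective (ContinuousLinearMap.id ℝ
        (TangentSpace (I.prod 𝓘(ℝ, V)) (φ u))) := fun _ _ h => h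
    rw [h2] at h3
    exact Function.Injective.of_comp h3
  refine injective_mfderiv_of_forall fun w hw => ?_
  set ζ : E × V := fderiv ℝ (C ∘ φ) u w with hζ
  -- the base component of `ζ` vanishes
  have hζ1 : ζ.1 = 0 := by
    have hπ : MDifferentiableAt (cotModel I) 𝓘(ℝ, E)
        (fun β : Cotangent I Q => extChartAt I (φ u).1 β.1) (iMap I F (φ u)) :=
      ((contMDiffAt_extChartAt' (n := ∞) (mem_chart_source H (φ u).1)).comp (iMap I F (φ u))
        (contMDiffAt_proj (fun q : Q => TangentSpace I q →L[ℝ] ℝ))).mdifferentiableAt (by simp)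
    have h1 := fderiv_comp_apply_eq_zero (ψ := iMap I F ∘ φ) hπ hψd hw
    have h2 := (hasFDerivAt_fst.comp u hCφ.hasFDerivAt).fderiv
    exact (congrArg (fun T : E →L[ℝ] E => T w) h2).symm.trans h1
  -- the derivative of the covector component along `ζ` vanishes
  have hζ2 : (fderiv ℝ (fderiv ℝ L) (C (φ u)) ζ).comp (ContinuousLinearMap.inl ℝ E V) = 0 := by
    have hτ : MDifferentiableAt (cotModel I) 𝓘(ℝ, E →L[ℝ] ℝ) (fun β : Cotangent I Q =>
        (trivializationAt (E →L[ℝ] ℝ) (fun q : Q => TangentSpace I q →L[ℝ] ℝ) (φ u).1 β).2)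
        (iMap I F (φ u)) :=
      (contMDiffAt_totalSpace.1 (contMDiffAt_id (x := iMap I F (φ u)) (I := cotModel I)
        (n := ∞))).2.mdifferentiableAt (by simp)
    have h1 := fderiv_comp_apply_eq_zero (ψ := iMap I F ∘ φ) hτ hψd hw
    have h2 : ((fun β : Cotangent I Q =>
        (trivializationAt (E →L[ℝ] ℝ) (fun q : Q => TangentSpace I q →L[ℝ] ℝ) (φ u).1 β).2) ∘
        (iMap I F ∘ φ)) =ᶠ[𝓝 u] fun u' => ((fderiv ℝ L ∘ (C ∘ φ)) u').comp
          (ContinuousLinearMap.inl ℝ E V) := by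
      filter_upwards [hnear] with u' hu' using trivializationAt_iMap hF.1 hu'.2
    have h3 : HasFDerivAt (fderiv ℝ L ∘ (C ∘ φ)) _ u :=
      HasFDerivAt.comp u hDL.hasFDerivAt hCφ.hasFDerivAt
    rw [h2.fderiv_eq, fderiv_clm_comp_const_apply h3.differentiableAt, h3.fderiv] at h1
    exact h1
  have hG : ∀ ξ, fderiv ℝ (dFiber F ∘ C.symm) (C (φ u)) ξ =
      (fderiv ℝ (fderiv ℝ L) (C (φ u)) ξ).comp (ContinuousLinearMap.inr ℝ E V) := by
    intro ξ
    have h1 : (dFiber F ∘ C.symm) =ᶠ[𝓝 (C (φ u))] fun z => (fderiv ℝ L z).comp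
        (ContinuousLinearMap.inr ℝ E V) := by
      filter_upwards [C.open_target.mem_nhds hpt] with z hz using dFiber_fiberChart_symm hF.1 hz
    rw [h1.fderiv_eq, fderiv_clm_comp_const_apply hDL]
  -- the derivative of the fibre component along `ζ` vanishes
  have hζ3 : (fderiv ℝ (fderiv ℝ L) (C (φ u)) ζ).comp (ContinuousLinearMap.inr ℝ E V) = 0 := by
    have h1 : ((dFiber F ∘ C.symm) ∘ (C ∘ φ)) =ᶠ[𝓝 u] fun _ => 0 := by
      filter_upwards [hnear] with u' hu'
      simp only [Function.comp_apply, C.left_inv hu'.2]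
      exact hφF u' hu'.1
    have h2 : DifferentiableAt ℝ (dFiber F ∘ C.symm) (C (φ u)) :=
      ((contDiffOn_dFiber_fiberChart_symm hF.1 _).contDiffAt
        (C.open_target.mem_nhds hpt)).differentiableAt (by simp)
    have h3 := (HasFDerivAt.comp u h2.hasFDerivAt hCφ.hasFDerivAt).fderiv
    rw [h1.fderiv_eq, fderiv_fun_const] at h3
    rw [← hG]
    exact (congrArg (fun T : E →L[ℝ] (V →L[ℝ] ℝ) => T w) h3).symm
  have hζ4 : fderiv ℝ (fderiv ℝ L) (C (φ u)) ζ = 0 := by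
    ext v
    · simpa using congrArg (fun T : E →L[ℝ] ℝ => T v) hζ2
    · simpa using congrArg (fun T : V →L[ℝ] ℝ => T v) hζ3
  have hsymm : ∀ ξ, fderiv ℝ (fderiv ℝ L) (C (φ u)) ξ ζ = 0 := by
    intro ξ
    rw [(hLat.isSymmSndFDerivAt (by
      rw [minSmoothness_of_isRCLikeNormedField]; exact WithTop.coe_le_coe.2 le_top)).eq ξ ζ, hζ4]
    rfl
  have hζv : ζ.2 = 0 := by
    rw [SeparatingDual.eq_zero_iff_forall_dual_eq_zero (R := ℝ)]
    intro l
    obtain ⟨ξ, hξ⟩ :=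
      surjective_fderiv_dFiber_fiberChart_symm hF.1 hp (hF.2 (φ u) (hφF u hu)) l
    rw [hG ξ] at hξ
    rw [← hsymm ξ, ← hξ]
    simp only [ContinuousLinearMap.comp_apply, ContinuousLinearMap.inr_apply]
    congr 1
    exact Prod.ext hζ1.symm rfl
  have hζ0 : mfderiv (I.prod 𝓘(ℝ, V)) 𝓘(ℝ, E × V) C (φ u)
      (mfderiv 𝓘(ℝ, E) (I.prod 𝓘(ℝ, V)) φ u w) = 0 := by
    rw [← mfderiv_comp_apply u hCm hφd w, mfderiv_eq_fderiv]
    exact Prod.ext hζ1 hζv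
  have h1 := hCinj (hζ0.trans (map_zero (mfderiv (I.prod 𝓘(ℝ, V)) 𝓘(ℝ, E × V) C (φ u))).symm)
  exact hinj (h1.trans (map_zero (mfderiv 𝓘(ℝ, E) (I.prod 𝓘(ℝ, V)) φ u)).symm)

theorem isLagrangianImmersion_iMap [FiniteDimensional ℝ E] [FiniteDimensional ℝ V]
    (hF : IsGeneratingFamily I F) :
    IsLagrangianImmersion (I.prod 𝓘(ℝ, V)) I (fiberCrit F) (iMap I F) := by
  refine ⟨isEmbeddedSubmanifold_fiberCrit hF, fun U φ hφ => ⟨?_, ?_, ?_⟩⟩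
  · exact (contMDiff_iMap hF.1).comp_contMDiffOn hφ.smooth
  all_goals
    have hφF : ∀ u ∈ U, φ u ∈ fiberCrit F := by
      obtain ⟨W, -, hW⟩ := hφ.image_eq
      intro u hu
      have : φ u ∈ φ '' U := mem_image_of_mem φ hu
      rw [hW] at this
      exact this.1
  · exact fun u hu => injective_mfderiv_iMap hF hφ.isOpen hφ.smooth hφF hu (hφ.immersion u hu)
  · intro u hu v w
    have hφat : ∀ u ∈ U, ContMDiffAt 𝓘(ℝ, E) (I.prod 𝓘(ℝ, V)) ∞ φ u := fun u hu =>
      hφ.smooth.contMDiffAt (hφ.isOpen.mem_nhds hu)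
    -- Near `u` the pullback of `λ` is the exact form `d(F ∘ φ)`, so its exterior derivative
    -- vanishes by symmetry of second derivatives.
    have h1 : pullbackLiouville I (iMap I F ∘ φ) =ᶠ[𝓝 u] fderiv ℝ (F ∘ φ) := by
      filter_upwards [hφ.isOpen.mem_nhds hu] with u' hu'
      exact pullbackLiouville_iMap hF.1 (hφat u' hu') (hφF u' hu')
    have h2 : ContDiffAt ℝ ∞ (F ∘ φ) u := (hF.1.contMDiffAt.comp u (hφat u hu)).contDiffAt
    rw [h1.fderiv_eq, sub_eq_zero]
    exact (h2.isSymmSndFDerivAt (by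
      rw [minSmoothness_of_isRCLikeNormedField]; exact WithTop.coe_le_coe.2 le_top)).eq v w

end Lagrangian

/-- For a right inverse `R` of `L`, invertibility of `L' ∘ R` is an open condition on `L'` and
forces `L'` to be surjective. -/
theorem isOpen_setOf_surjective {E W : Type*} [NormedAddCommGroup E] [NormedSpace ℝ E]
    [NormedAddCommGroup W] [NormedSpace ℝ W] [FiniteDimensional ℝ W] :
    IsOpen {L : E →L[ℝ] W | Function.Surjective L} := by
  have : CompleteSpace W := FiniteDimensional.complete ℝ W
  rw [isOpen_iff_mem_nhds]
  intro L hL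
  obtain ⟨R, hR⟩ := L.toLinearMap.exists_rightInverse_of_surjective (LinearMap.range_eq_top.2 hL)
  let R' : W →L[ℝ] E := LinearMap.toContinuousLinearMap R
  have hLR : L.comp R' = 1 := by
    ext w
    exact congrArg (fun T : W →ₗ[ℝ] W => T w) hR
  have hcont : Continuous fun L' : E →L[ℝ] W => L'.comp R' := by fun_prop
  have hopen : IsOpen {L' : E →L[ℝ] W | IsUnit (L'.comp R')} := Units.isOpen.preimage hcont
  refine Filter.mem_of_superset (hopen.mem_nhds (show IsUnit (L.comp R') by
    rw [hLR]; exact isUnit_one)) ?_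
  rintro L' ⟨T, hT⟩ w
  refine ⟨R' ((T⁻¹ : (W →L[ℝ] W)ˣ).1 w), ?_⟩
  have h1 : (T.1 * (T⁻¹ : (W →L[ℝ] W)ˣ).1) w = w := by simp
  rw [hT] at h1
  exact h1

/-! ### Sard's theorem on manifolds -/

section ManifoldSard

universe u

variable {E W : Type u} [NormedAddCommGroup E] [NormedSpace ℝ E] [FiniteDimensional ℝ E]
  [NormedAddCommGroup W] [NormedSpace ℝ W] [FiniteDimensional ℝ W]
  {H : Type*} [TopologicalSpace H] {J : ModelWithCorners ℝ E H} [J.Boundaryless]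
  {X : Type*} [TopologicalSpace X] [ChartedSpace H X] [IsManifold J ∞ X]
  [SecondCountableTopology X]

/-- **Sard's theorem** for smooth maps from a manifold to a vector space. -/
theorem measure_image_not_surjective_mfderiv_eq_zero [MeasurableSpace W] [BorelSpace W]
    (μ : Measure W) [μ.IsAddHaarMeasure] {g : X → W} (hg : ContMDiff J 𝓘(ℝ, W) ∞ g) :
    μ (g '' {p | ¬ Function.Surjective (mfderiv J 𝓘(ℝ, W) g p)}) = 0 := by
  refine measure_image_eq_zero_of_locally μ fun p _ => ?_
  set c := extChartAt J p with hc
  refine ⟨c.source, extChartAt_source_mem_nhds p, ?_⟩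
  have hcs : ContMDiffOn 𝓘(ℝ, E) J ∞ c.symm c.target := contMDiffOn_extChartAt_symm p
  have hto : IsOpen c.target := isOpen_extChartAt_target p
  have hgs : ContDiffOn ℝ ∞ (g ∘ c.symm) c.target := (hg.comp_contMDiffOn hcs).contDiffOn
  refine measure_mono_null ?_ (measure_image_not_surjective_fderiv_eq_zero μ hto hgs)
  rintro _ ⟨q, ⟨hq, hqc⟩, rfl⟩
  have hqq : c.symm (c q) = q := c.left_inv hqc
  refine ⟨c q, ⟨c.map_source hqc, fun hs => hq ?_⟩, by simp [hqq]⟩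
  have h1 := mfderiv_comp (c q) (hg.contMDiffAt.mdifferentiableAt (by simp) :
      MDifferentiableAt J 𝓘(ℝ, W) g (c.symm (c q)))
    ((hcs.contMDiffAt (hto.mem_nhds (c.map_source hqc))).mdifferentiableAt (by simp))
  rw [← mfderiv_eq_fderiv, h1] at hs
  have h2 : Function.Surjective (mfderiv J 𝓘(ℝ, W) g (c.symm (c q))) :=
    Function.Surjective.of_comp hs
  rwa [hqq] at h2

/-- The critical values form a null set, whereas a ball has positive Haar measure. -/
theorem exists_norm_lt_regular_value {g : X → W} (hg : ContMDiff J 𝓘(ℝ, W) ∞ g) {δ : ℝ}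
    (hδ : 0 < δ) :
    ∃ e : W, ‖e‖ < δ ∧ ∀ p, g p = e → Function.Surjective (mfderiv J 𝓘(ℝ, W) g p) := by
  let _ : MeasurableSpace W := borel W
  have : BorelSpace W := ⟨rfl⟩
  have h0 := measure_image_not_surjective_mfderiv_eq_zero Measure.addHaar hg
  obtain ⟨e, heb, he⟩ : ∃ e ∈ Metric.ball (0 : W) δ,
      e ∉ g '' {p | ¬ Function.Surjective (mfderiv J 𝓘(ℝ, W) g p)} := by
    by_contra! h
    exact (Metric.measure_ball_pos Measure.addHaar (0 : W) hδ).ne' (measure_mono_null h h0)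
  refine ⟨e, by simpa using heb, fun p hp => ?_⟩
  by_contra h
  exact he ⟨p, h, hp⟩

end ManifoldSard

/-! ### Small covectors are regular values -/

section SmallRegularValues

variable {E : Type*} [NormedAddCommGroup E] [NormedSpace ℝ E]
  {H : Type*} [TopologicalSpace H] {I : ModelWithCorners ℝ E H} [I.Boundaryless]
  {Q : Type*} [TopologicalSpace Q] [ChartedSpace H Q] [IsManifold I ∞ Q]
  {V : Type*} [NormedAddCommGroup V] [NormedSpace ℝ V] {F : Q × V → ℝ}

theorem dFiber_eq_of_notMem {K : Set (Q × V)} (hK : IsClosed K) {A : V →L[ℝ] ℝ}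
    (hA : ∀ p, p ∉ K → F p = A p.2) {p : Q × V} (hp : p ∉ K) : dFiber F p = A := by
  have h1 : (fun η => F (p.1, η)) =ᶠ[𝓝 p.2] A := by
    have hc : Continuous fun η : V => (p.1, η) := by fun_prop
    filter_upwards [(hK.isOpen_compl.preimage hc).mem_nhds (show (p.1, p.2) ∈ Kᶜ from hp)]
      with η hη using hA _ hη
  rw [dFiber, h1.fderiv_eq, A.fderiv]

theorem eventually_surjective_mfderiv_dFiber [FiniteDimensional ℝ V]
    (hF : ContMDiff (I.prod 𝓘(ℝ, V)) 𝓘(ℝ, ℝ) ∞ F) {p : Q × V}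
    (hs : Function.Surjective (mfderiv (I.prod 𝓘(ℝ, V)) 𝓘(ℝ, V →L[ℝ] ℝ) (dFiber F) p)) :
    ∀ᶠ p' in 𝓝 p,
      Function.Surjective (mfderiv (I.prod 𝓘(ℝ, V)) 𝓘(ℝ, V →L[ℝ] ℝ) (dFiber F) p') := by
  have hp := mem_fiberChart_source_self I p
  set C := fiberChart I V p.1
  have h1 := surjective_fderiv_dFiber_fiberChart_symm hF hp hs
  have hpt : C p ∈ C.target := C.map_source hp
  have hG : ContinuousAt (fderiv ℝ (dFiber F ∘ C.symm)) (C p) :=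
    ((contDiffOn_dFiber_fiberChart_symm hF p.1).continuousOn_fderiv_of_isOpen C.open_target
      (by simp)).continuousAt (C.open_target.mem_nhds hpt)
  have h2 : ∀ᶠ p' in 𝓝 p, Function.Surjective (fderiv ℝ (dFiber F ∘ C.symm) (C p')) :=
    (hG.comp (C.continuousAt hp)).eventually (isOpen_setOf_surjective.mem_nhds h1)
  filter_upwards [h2, C.open_source.mem_nhds hp] with p' hs' hp'
  have hpp : C.symm (C p') = p' := C.left_inv hp'
  have h3 := mfderiv_comp (C p') ((contMDiff_dFiber hF).contMDiffAt.mdifferentiableAt (by simp) :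
      MDifferentiableAt (I.prod 𝓘(ℝ, V)) 𝓘(ℝ, V →L[ℝ] ℝ) (dFiber F) (C.symm (C p')))
    ((contMDiffAt_fiberChart_symm I (C.map_source hp')).mdifferentiableAt (by simp))
  rw [← mfderiv_eq_fderiv, h3] at hs'
  have h4 : Function.Surjective
      (mfderiv (I.prod 𝓘(ℝ, V)) 𝓘(ℝ, V →L[ℝ] ℝ) (dFiber F) (C.symm (C p'))) :=
    Function.Surjective.of_comp hs'
  rwa [hpp] at h4

/-- For a linear-at-infinity generating family, small covectors are regular values of `∂_η F`. -/
theorem exists_forall_norm_lt_isFiberRegularValue [FiniteDimensional ℝ V] [T2Space Q]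
    (hF : IsGeneratingFamily I F) {A : V →L[ℝ] ℝ} (hA0 : A ≠ 0) (hA : AgreesAtInfinity F A) :
    ∃ δ > 0, ∀ c : V →L[ℝ] ℝ, ‖c‖ < δ → IsFiberRegularValue I F c := by
  obtain ⟨K, hK, hKA⟩ := hA
  -- Compactness of `K` reduces this to a neighbourhood of one point. At a fibre critical point
  -- surjectivity persists nearby; elsewhere half of `‖dFiber F p‖` is a threshold below which the
  -- condition is vacuous.
  have hloc : ∃ δ > 0, ∀ p ∈ K, ‖dFiber F p‖ < δ →
      Function.Surjective (mfderiv (I.prod 𝓘(ℝ, V)) 𝓘(ℝ, V →L[ℝ] ℝ) (dFiber F) p) := by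
    refine hK.induction_on (p := fun S => ∃ δ > 0, ∀ p ∈ S, ‖dFiber F p‖ < δ →
      Function.Surjective (mfderiv (I.prod 𝓘(ℝ, V)) 𝓘(ℝ, V →L[ℝ] ℝ) (dFiber F) p))
      ⟨1, one_pos, by simp⟩ ?_ ?_ ?_
    · rintro S T hST ⟨δ, hδ, h⟩
      exact ⟨δ, hδ, fun p hp => h p (hST hp)⟩
    · rintro S T ⟨δ, hδ, h⟩ ⟨δ', hδ', h'⟩
      refine ⟨min δ δ', lt_min hδ hδ', fun p hp hpδ => ?_⟩
      rcases hp with hp | hp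
      · exact h p hp (hpδ.trans_le (min_le_left _ _))
      · exact h' p hp (hpδ.trans_le (min_le_right _ _))
    · intro p _
      by_cases hp0 : dFiber F p = 0
      · exact ⟨_, mem_nhdsWithin_of_mem_nhds (eventually_surjective_mfderiv_dFiber hF.1
          (hF.2 p hp0)), 1, one_pos, fun p' hp' _ => hp'⟩
      · have hpos : 0 < ‖dFiber F p‖ / 2 := by positivity
        have hc : ContinuousAt (fun p' => ‖dFiber F p'‖) p :=
          (contMDiff_dFiber hF.1).continuous.norm.continuousAt
        exact ⟨_, mem_nhdsWithin_of_mem_nhds (hc.eventually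
          (lt_mem_nhds (half_lt_self (norm_pos_iff.2 hp0)))), _, hpos,
          fun p' hp' hlt => absurd hlt (not_lt.2 (le_of_lt hp'))⟩
  obtain ⟨δ, hδ, h⟩ := hloc
  -- Off `K` the fibre derivative is `A`, so a covector shorter than `A` is not attained there.
  refine ⟨min δ ‖A‖, lt_min hδ (norm_pos_iff.2 hA0), fun c hc p hp => ?_⟩
  by_cases hpK : p ∈ K
  · exact h p hpK (by rw [hp]; exact hc.trans_le (min_le_left _ _))
  · rw [dFiber_eq_of_notMem hK.isClosed hKA hpK] at hp
    rw [← hp] at hc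
    exact absurd (hc.trans_le (min_le_right _ _)) (lt_irrefl _)

end SmallRegularValues

/-! ### The interpolating family -/

section Interpolation

variable {n N : ℕ} {M : Type*} [TopologicalSpace M] [ChartedSpace (EuclideanSpace ℝ (Fin n)) M]

/-- `(t, x, η) ↦ t (σ(t) f(x, η) + (1 - σ(t)) A(η)) - ε(t) η`. -/
def interpolation (f : M × EuclideanSpace ℝ (Fin N) → ℝ) (A : EuclideanSpace ℝ (Fin N) →L[ℝ] ℝ)
    (σ : ℝ → ℝ) (ε : ℝ → EuclideanSpace ℝ (Fin N) →L[ℝ] ℝ)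
    (p : (RPos × M) × EuclideanSpace ℝ (Fin N)) : ℝ :=
  (p.1.1 : ℝ) * (σ p.1.1 * f (p.1.2, p.2) + (1 - σ p.1.1) * A p.2) - ε p.1.1 p.2

/-- `(t, x, η) ↦ σ(t) ∂_η f(x, η) + (1 - σ(t)) A`. -/
noncomputable def interpolationDeriv (f : M × EuclideanSpace ℝ (Fin N) → ℝ)
    (A : EuclideanSpace ℝ (Fin N) →L[ℝ] ℝ) (σ : ℝ → ℝ)
    (p : (RPos × M) × EuclideanSpace ℝ (Fin N)) : EuclideanSpace ℝ (Fin N) →L[ℝ] ℝ :=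
  σ p.1.1 • dFiber f (p.1.2, p.2) + (1 - σ p.1.1) • A

variable {f : M × EuclideanSpace ℝ (Fin N) → ℝ} {A : EuclideanSpace ℝ (Fin N) →L[ℝ] ℝ}
  {σ : ℝ → ℝ} {ε : ℝ → EuclideanSpace ℝ (Fin N) →L[ℝ] ℝ}

theorem contMDiff_time : ContMDiff ((cylModel n).prod 𝓘(ℝ, EuclideanSpace ℝ (Fin N))) 𝓘(ℝ, ℝ) ∞
    (fun p : (RPos × M) × EuclideanSpace ℝ (Fin N) => (p.1.1 : ℝ)) :=
  (contMDiff_subtype_val (I := 𝓘(ℝ, ℝ)) (U := RPos)).comp (contMDiff_fst.comp contMDiff_fst)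

theorem contMDiff_space : ContMDiff ((cylModel n).prod 𝓘(ℝ, EuclideanSpace ℝ (Fin N)))
    ((𝓡 n).prod 𝓘(ℝ, EuclideanSpace ℝ (Fin N))) ∞
    (fun p : (RPos × M) × EuclideanSpace ℝ (Fin N) => (p.1.2, p.2)) :=
  (contMDiff_snd.comp contMDiff_fst).prodMk contMDiff_snd

theorem contMDiff_interpolation
    (hf : ContMDiff ((𝓡 n).prod 𝓘(ℝ, EuclideanSpace ℝ (Fin N))) 𝓘(ℝ, ℝ) ∞ f)
    (hσ : ContDiff ℝ ∞ σ) (hε : ContDiff ℝ ∞ ε) :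
    ContMDiff ((cylModel n).prod 𝓘(ℝ, EuclideanSpace ℝ (Fin N))) 𝓘(ℝ, ℝ) ∞
      (interpolation f A σ ε) := by
  have ht := contMDiff_time (n := n) (N := N) (M := M)
  have hσt := hσ.contMDiff.comp ht
  have hεt := hε.contMDiff.comp ht
  have hA : ContMDiff ((cylModel n).prod 𝓘(ℝ, EuclideanSpace ℝ (Fin N))) 𝓘(ℝ, ℝ) ∞
      (fun p : (RPos × M) × EuclideanSpace ℝ (Fin N) => A p.2) :=
    A.contDiff.contMDiff.comp contMDiff_snd
  have hff := hf.comp (contMDiff_space (n := n) (N := N) (M := M))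
  exact (ht.mul ((hσt.mul hff).add ((contMDiff_const.sub hσt).mul hA))).sub
    (hεt.clm_apply contMDiff_snd)

theorem dFiber_interpolation
    (hf : ContMDiff ((𝓡 n).prod 𝓘(ℝ, EuclideanSpace ℝ (Fin N))) 𝓘(ℝ, ℝ) ∞ f)
    (p : (RPos × M) × EuclideanSpace ℝ (Fin N)) :
    dFiber (interpolation f A σ ε) p =
      (p.1.1 : ℝ) • interpolationDeriv f A σ p - ε p.1.1 := by
  have h1 : DifferentiableAt ℝ (fun η => f (p.1.2, η)) p.2 :=
    ((hf.contMDiffAt (x := (p.1.2, p.2))).comp p.2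
      (contMDiffAt_const.prodMk contMDiffAt_id)).contDiffAt.differentiableAt (by simp)
  exact (((h1.hasFDerivAt.const_mul (σ p.1.1)).add
    (A.hasFDerivAt.const_mul (1 - σ p.1.1))).const_mul (p.1.1 : ℝ)).sub
      (ε p.1.1).hasFDerivAt |>.fderiv

variable [IsManifold (𝓡 n) ∞ M]

theorem contMDiff_interpolationDeriv
    (hf : ContMDiff ((𝓡 n).prod 𝓘(ℝ, EuclideanSpace ℝ (Fin N))) 𝓘(ℝ, ℝ) ∞ f)
    (hσ : ContDiff ℝ ∞ σ) :
    ContMDiff ((cylModel n).prod 𝓘(ℝ, EuclideanSpace ℝ (Fin N)))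
      𝓘(ℝ, EuclideanSpace ℝ (Fin N) →L[ℝ] ℝ) ∞ (interpolationDeriv f A σ) := by
  have hσt := hσ.contMDiff.comp (contMDiff_time (n := n) (N := N) (M := M))
  have hff := (contMDiff_dFiber hf).comp (contMDiff_space (n := n) (N := N) (M := M))
  exact (hσt.smul hff).add ((contMDiff_const.sub hσt).smul contMDiff_const)

end Interpolation

/-! ### Zero is a regular value -/

section Regularity

/-- At a point where `ψ = e` the term containing the derivative of `a` drops out, so the derivative
is `a p` times that of `ψ`. Thus the factor `t` in `∂_η F` does not affect regularity. -/
theorem surjective_mfderiv_smul_sub {E' : Type*} [NormedAddCommGroup E'] [NormedSpace ℝ E']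
    {H' : Type*} [TopologicalSpace H'] {J : ModelWithCorners ℝ E' H'}
    {X : Type*} [TopologicalSpace X] [ChartedSpace H' X]
    {W : Type*} [NormedAddCommGroup W] [NormedSpace ℝ W] {a : X → ℝ} {ψ : X → W} {p : X} {e : W}
    (ha : MDifferentiableAt J 𝓘(ℝ, ℝ) a p) (hψ : MDifferentiableAt J 𝓘(ℝ, W) ψ p)
    (ha0 : a p ≠ 0) (hp : ψ p = e) (hs : Function.Surjective (mfderiv J 𝓘(ℝ, W) ψ p)) :
    Function.Surjective (mfderiv J 𝓘(ℝ, W) (fun x => a x • (ψ x - e)) p) := by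
  have h1 : HasFDerivAt (fun z : ℝ × W => z.1 • (z.2 - e)) (a p • ContinuousLinearMap.snd ℝ ℝ W)
      (a p, ψ p) := by
    refine ((hasFDerivAt_fst (𝕜 := ℝ) (E := ℝ) (F := W) (p := (a p, ψ p))).smul
      ((hasFDerivAt_snd (𝕜 := ℝ) (E := ℝ) (F := W) (p := (a p, ψ p))).sub_const e)).congr_fderiv ?_
    ext <;> simp [hp]
  have h0 : HasMFDerivAt J 𝓘(ℝ, ℝ × W) (fun x => (a x, ψ x)) p
      ((mfderiv J 𝓘(ℝ, ℝ) a p).prod (mfderiv J 𝓘(ℝ, W) ψ p)) :=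
    ⟨ha.hasMFDerivAt.1.prodMk hψ.hasMFDerivAt.1, ha.hasMFDerivAt.2.prodMk hψ.hasMFDerivAt.2⟩
  have h2 := HasMFDerivAt.comp (f := fun x => (a x, ψ x)) p h1.hasMFDerivAt h0
  have h3 : mfderiv J 𝓘(ℝ, W) (fun x => a x • (ψ x - e)) p = _ := h2.mfderiv
  rw [h3]
  intro w
  obtain ⟨v, hv⟩ := hs ((a p)⁻¹ • w)
  refine ⟨v, ?_⟩
  change a p • (mfderiv J 𝓘(ℝ, W) ψ p v) = w
  rw [hv]
  exact smul_inv_smul₀ ha0 w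

variable {n N : ℕ} {M : Type*} [TopologicalSpace M] [ChartedSpace (EuclideanSpace ℝ (Fin n)) M]
  {f : M × EuclideanSpace ℝ (Fin N) → ℝ} {A e : EuclideanSpace ℝ (Fin N) →L[ℝ] ℝ} {σ ρ : ℝ → ℝ}

/-- The derivative along the slice of constant `t` factors through the full derivative. -/
theorem surjective_mfderiv_of_slice {ψ : (RPos × M) × EuclideanSpace ℝ (Fin N) →
      EuclideanSpace ℝ (Fin N) →L[ℝ] ℝ} {p : (RPos × M) × EuclideanSpace ℝ (Fin N)}
    (hψ : MDifferentiableAt ((cylModel n).prod 𝓘(ℝ, EuclideanSpace ℝ (Fin N)))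
      𝓘(ℝ, EuclideanSpace ℝ (Fin N) →L[ℝ] ℝ) ψ p)
    (hs : Function.Surjective (mfderiv ((𝓡 n).prod 𝓘(ℝ, EuclideanSpace ℝ (Fin N)))
      𝓘(ℝ, EuclideanSpace ℝ (Fin N) →L[ℝ] ℝ)
      (fun q : M × EuclideanSpace ℝ (Fin N) => ψ ((p.1.1, q.1), q.2)) (p.1.2, p.2))) :
    Function.Surjective (mfderiv ((cylModel n).prod 𝓘(ℝ, EuclideanSpace ℝ (Fin N)))
      𝓘(ℝ, EuclideanSpace ℝ (Fin N) →L[ℝ] ℝ) ψ p) := by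
  have h1 : MDifferentiableAt ((𝓡 n).prod 𝓘(ℝ, EuclideanSpace ℝ (Fin N)))
      ((cylModel n).prod 𝓘(ℝ, EuclideanSpace ℝ (Fin N)))
      (fun q : M × EuclideanSpace ℝ (Fin N) => ((p.1.1, q.1), q.2)) (p.1.2, p.2) :=
    (mdifferentiableAt_const.prodMk mdifferentiableAt_fst).prodMk mdifferentiableAt_snd
  have h2 := mfderiv_comp (g := ψ) (p.1.2, p.2) hψ h1
  have h3 : Function.Surjective _ := h2 ▸ hs
  exact Function.Surjective.of_comp h3

variable [IsManifold (𝓡 n) ∞ M]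

/-- The interpolation is a generating family if `e` is a small regular value of the fibre
derivative before the perturbation. -/
theorem isGeneratingFamily_interpolation (hf : IsGeneratingFamily (𝓡 n) f)
    (hσ : ContDiff ℝ ∞ σ) (hσ0 : ∀ t ≤ 1, σ t = 0) (hσ1 : ∀ t, 2 ≤ t → σ t = 1)
    (hρ : ContDiff ℝ ∞ ρ) (hρ1 : ∀ t, 1 ≤ t → t ≤ 2 → ρ t = 1) (hρn : ∀ t, |ρ t| ≤ 1)
    (heA : ‖e‖ < ‖A‖) (hef : ∀ c, ‖c‖ ≤ ‖e‖ → IsFiberRegularValue (𝓡 n) f c)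
    (hei : ∀ p, interpolationDeriv f A σ p = e → Function.Surjective
      (mfderiv ((cylModel n).prod 𝓘(ℝ, EuclideanSpace ℝ (Fin N)))
        𝓘(ℝ, EuclideanSpace ℝ (Fin N) →L[ℝ] ℝ) (interpolationDeriv f A σ) p)) :
    IsGeneratingFamily (cylModel n)
      (interpolation f A σ fun t => (t * ρ t) • e : (RPos × M) × EuclideanSpace ℝ (Fin N) → ℝ) := by
  have hF := contMDiff_interpolation (M := M) (A := A) (ε := fun t => (t * ρ t) • e) hf.1 hσ
    ((contDiff_id.mul hρ).smul contDiff_const)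
  refine ⟨hF, fun p hp => ?_⟩
  have hd : dFiber (interpolation f A σ fun t => (t * ρ t) • e :
      (RPos × M) × EuclideanSpace ℝ (Fin N) → ℝ) =
      fun p => (p.1.1 : ℝ) • (interpolationDeriv f A σ p - ρ p.1.1 • e) := by
    ext1 p
    rw [dFiber_interpolation hf.1, smul_sub, smul_smul]
  have ht : (0 : ℝ) < p.1.1 := p.1.1.2
  have hρe : ∀ t, ‖ρ t • e‖ ≤ ‖e‖ := fun t => by
    rw [norm_smul]
    exact mul_le_of_le_one_left (norm_nonneg _) (hρn t)
  have hp0 : interpolationDeriv f A σ p = ρ p.1.1 • e := by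
    have := congrFun hd p ▸ hp
    exact sub_eq_zero.1 ((smul_eq_zero.1 this).resolve_left ht.ne')
  have hid := contMDiff_interpolationDeriv (A := A) hf.1 hσ
  -- For `t ≤ 1` the critical equation reads `A = ρ e`, impossible since `‖e‖ < ‖A‖`.
  rcases le_or_gt (p.1.1 : ℝ) 1 with h1 | h1
  · rw [interpolationDeriv, hσ0 _ h1, zero_smul, zero_add, sub_zero, one_smul] at hp0
    have := hρe p.1.1
    rw [← hp0] at this
    exact absurd heA (not_lt.2 this)
  rcases lt_or_ge (p.1.1 : ℝ) 2 with h2 | h2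
  · have hev : dFiber (interpolation f A σ fun t => (t * ρ t) • e) =ᶠ[𝓝 p]
        fun p => (p.1.1 : ℝ) • (interpolationDeriv f A σ p - e) := by
      have hc : ContinuousAt (fun p : (RPos × M) × EuclideanSpace ℝ (Fin N) => (p.1.1 : ℝ)) p :=
        (contMDiff_time (n := n)).continuous.continuousAt
      filter_upwards [hc.eventually (Ioo_mem_nhds h1 h2)] with q hq
      simp only [hd, hρ1 _ hq.1.le hq.2.le, one_smul]
    rw [hev.mfderiv_eq]
    rw [hρ1 _ h1.le h2.le, one_smul] at hp0
    exact surjective_mfderiv_smul_sub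
      (contMDiff_time.contMDiffAt.mdifferentiableAt (by simp))
      (hid.contMDiffAt.mdifferentiableAt (by simp)) ht.ne' hp0 (hei p hp0)
  · refine surjective_mfderiv_of_slice
      ((contMDiff_dFiber hF).contMDiffAt.mdifferentiableAt (by simp)) ?_
    have hs : (fun q : M × EuclideanSpace ℝ (Fin N) =>
        dFiber (interpolation f A σ fun t => (t * ρ t) • e) ((p.1.1, q.1), q.2)) =
        fun q => (p.1.1 : ℝ) • (dFiber f q - ρ p.1.1 • e) := by
      ext1 q
      simp only [hd, interpolationDeriv, hσ1 _ h2, one_smul, sub_self, zero_smul, add_zero]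
    have hp1 : dFiber f (p.1.2, p.2) = ρ p.1.1 • e := by
      simpa only [interpolationDeriv, hσ1 _ h2, one_smul, sub_self, zero_smul, add_zero] using hp0
    rw [hs]
    exact surjective_mfderiv_smul_sub (a := fun _ => (p.1.1 : ℝ)) mdifferentiableAt_const
      ((contMDiff_dFiber hf.1).contMDiffAt.mdifferentiableAt (by simp)) ht.ne' hp1
      (hef _ (hρe _) _ hp1)

end Regularity

/-! ### The cylindrical end and compactness -/

section Ends

variable {n N : ℕ} {M : Type*} [TopologicalSpace M] [ChartedSpace (EuclideanSpace ℝ (Fin n)) M]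
  {f : M × EuclideanSpace ℝ (Fin N) → ℝ} {F : (RPos × M) × EuclideanSpace ℝ (Fin N) → ℝ}

theorem dFiber_eq_smul_dFiber
    (hf : ContMDiff ((𝓡 n).prod 𝓘(ℝ, EuclideanSpace ℝ (Fin N))) 𝓘(ℝ, ℝ) ∞ f)
    {p : (RPos × M) × EuclideanSpace ℝ (Fin N)}
    (hF : ∀ η, F (p.1, η) = (p.1.1 : ℝ) * f (p.1.2, η)) :
    dFiber F p = (p.1.1 : ℝ) • dFiber f (p.1.2, p.2) := by
  have h1 : DifferentiableAt ℝ (fun η => f (p.1.2, η)) p.2 :=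
    ((hf.contMDiffAt (x := (p.1.2, p.2))).comp p.2
      (contMDiffAt_const.prodMk contMDiffAt_id)).contDiffAt.differentiableAt (by simp)
  rw [dFiber, funext hF]
  exact (h1.hasFDerivAt.const_mul (p.1.1 : ℝ)).fderiv

/-- For a function of the form `t f(x, η)` near a point, `i_F` is the image of `j_f` in the
symplectization. -/
theorem symplToCotangent_jMap [IsManifold (𝓡 n) ∞ M]
    (hf : ContMDiff ((𝓡 n).prod 𝓘(ℝ, EuclideanSpace ℝ (Fin N))) 𝓘(ℝ, ℝ) ∞ f) {a s : ℝ}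
    (ha : a < Real.exp s)
    (hF : ∀ p : (RPos × M) × EuclideanSpace ℝ (Fin N), a ≤ p.1.1 →
      F p = (p.1.1 : ℝ) * f (p.1.2, p.2)) (p : M × EuclideanSpace ℝ (Fin N)) :
    symplToCotangent (s, jMap (𝓡 n) f p) =
      iMap (cylModel n) F ((⟨Real.exp s, Real.exp_pos s⟩, p.1), p.2) := by
  obtain ⟨x, η⟩ := p
  let q : RPos × M := (⟨Real.exp s, Real.exp_pos s⟩, x)
  -- The strict inequality `a < exp s` gives equality with `t f` on a neighbourhood, hence equality
  -- of `t`-derivatives as well; these produce the coefficient `z = f` of `dt`.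
  have hev : (fun q' : RPos × M => F (q', η)) =ᶠ[𝓝 q]
      fun q' : RPos × M => (q'.1 : ℝ) * f (q'.2, η) := by
    have hc : Continuous fun q' : RPos × M => (q'.1 : ℝ) := by fun_prop
    filter_upwards [hc.continuousAt.eventually (lt_mem_nhds (show a < ((q.1 : RPos) : ℝ) from ha))]
      with q' hq' using hF (q', η) (le_of_lt hq')
  have h1 : MDifferentiableAt (cylModel n) 𝓘(ℝ, ℝ) (fun q' : RPos × M => (q'.1 : ℝ)) q :=
    (((contMDiff_subtype_val (n := ∞) (I := 𝓘(ℝ, ℝ)) (U := RPos)).comp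
      contMDiff_fst).contMDiffAt).mdifferentiableAt (by simp)
  have h2 : MDifferentiableAt (𝓡 n) 𝓘(ℝ, ℝ) (fun x' : M => f (x', η)) x :=
    (hf.comp (contMDiff_id.prodMk contMDiff_const)).contMDiffAt.mdifferentiableAt (by simp)
  have h3 : HasMFDerivAt (cylModel n) 𝓘(ℝ, ℝ) (fun q' : RPos × M => f (q'.2, η)) q _ :=
    HasMFDerivAt.comp (g := fun x' : M => f (x', η)) q h2.hasMFDerivAt
      (mdifferentiableAt_snd (I := 𝓘(ℝ, ℝ)) (I' := 𝓡 n) (x := q)).hasMFDerivAt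
  have h4 := (HasMFDerivAt.mul h1.hasMFDerivAt h3).mfderiv
  refine congrArg (TotalSpace.mk q) ?_
  refine Eq.trans ?_ (hev.mfderiv_eq.trans h4).symm
  exact add_comm _ _

theorem image_fiberCrit_upper_end [IsManifold (𝓡 n) ∞ M]
    (hf : ContMDiff ((𝓡 n).prod 𝓘(ℝ, EuclideanSpace ℝ (Fin N))) 𝓘(ℝ, ℝ) ∞ f) {a b : ℝ}
    (ha : 0 < a) (hab : a < b)
    (hF : ∀ p : (RPos × M) × EuclideanSpace ℝ (Fin N), a ≤ p.1.1 →
      F p = (p.1.1 : ℝ) * f (p.1.2, p.2)) :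
    iMap (cylModel n) F '' fiberCrit F ∩ {α | b ≤ tCoord α} =
      symplToCotangent '' (Ici (Real.log b) ×ˢ (jMap (𝓡 n) f '' fiberCrit f)) := by
  have hb : 0 < b := ha.trans hab
  have hcrit : ∀ p : (RPos × M) × EuclideanSpace ℝ (Fin N), a ≤ p.1.1 →
      (p ∈ fiberCrit F ↔ (p.1.2, p.2) ∈ fiberCrit f) := fun p hp => by
    have hp0 : (p.1.1 : ℝ) ≠ 0 := (ha.trans_le hp).ne'
    simp only [fiberCrit, mem_ofPred_eq, dFiber_eq_smul_dFiber hf fun η => hF (p.1, η) hp,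
      smul_eq_zero, hp0, false_or]
  ext α
  constructor
  · rintro ⟨⟨⟨⟨t, x⟩, η⟩, hp, rfl⟩, hb'⟩
    have hbt : b ≤ (t : ℝ) := hb'
    have ht : 0 < (t : ℝ) := t.2
    have het : Real.exp (Real.log t) = t := Real.exp_log ht
    refine ⟨(Real.log t, jMap (𝓡 n) f (x, η)), ⟨Real.log_le_log hb hbt, (x, η),
      (hcrit _ (hab.le.trans hbt)).1 hp, rfl⟩, ?_⟩
    rw [symplToCotangent_jMap hf (by rw [het]; exact hab.trans_le hbt) hF]
    simp only [het]
  · rintro ⟨⟨s, _⟩, ⟨hs, ⟨x, η⟩, hp, rfl⟩, rfl⟩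
    have hbs : b ≤ Real.exp s := (Real.log_le_iff_le_exp hb).1 hs
    have has := hab.trans_le hbs
    rw [symplToCotangent_jMap hf has hF]
    exact ⟨⟨_, (hcrit ((⟨Real.exp s, Real.exp_pos s⟩, x), η) has.le).2 hp, rfl⟩, hbs⟩

/-- `0 < a` keeps `[a, b]` away from the missing endpoint of `ℝ₊`, so its preimage there is compact.
-/
theorem isCompact_fiberCrit_inter (hF : Continuous (dFiber F))
    {K : Set (M × EuclideanSpace ℝ (Fin N))} (hK : IsCompact K)
    (h : ∀ p ∈ fiberCrit F, (p.1.2, p.2) ∈ K) {a b : ℝ} (ha : 0 < a) :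
    IsCompact (fiberCrit F ∩ {p | (p.1.1 : ℝ) ∈ Icc a b}) := by
  have h1 : IsCompact {t : RPos | (t : ℝ) ∈ Icc a b} := by
    rw [Subtype.isCompact_iff]
    convert isCompact_Icc (a := a) (b := b) using 1
    ext t
    exact ⟨by rintro ⟨t, ht, rfl⟩; exact ht, fun ht => ⟨⟨t, ha.trans_le ht.1⟩, ht, rfl⟩⟩
  refine ((h1.prod hK).image (f := fun z => ((z.1, z.2.1), z.2.2)) (by fun_prop)).of_isClosed_subset
    ?_ ?_
  · exact (isClosed_singleton.preimage hF).inter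
      (isClosed_Icc.preimage (show Continuous fun p : (RPos × M) × EuclideanSpace ℝ (Fin N) =>
        (p.1.1 : ℝ) by fun_prop))
  · rintro ⟨⟨t, x⟩, η⟩ ⟨hp, ht⟩
    exact ⟨(t, (x, η)), ⟨ht, h _ hp⟩, rfl⟩

end Ends

/-! ### Assembling the cobordism -/

section Filling

variable {n N : ℕ} {M : Type*} [TopologicalSpace M] [ChartedSpace (EuclideanSpace ℝ (Fin n)) M]
  {f : M × EuclideanSpace ℝ (Fin N) → ℝ} {A e : EuclideanSpace ℝ (Fin N) →L[ℝ] ℝ} {σ ρ : ℝ → ℝ}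

theorem dFiber_snd {Q V : Type*} [NormedAddCommGroup V] [NormedSpace ℝ V] (A : V →L[ℝ] ℝ) :
    dFiber (fun p : Q × V => A p.2) = fun _ => A := funext fun _ => A.fderiv

/-- A linear function generates the empty Legendrian. -/
theorem generatesLegendrian_empty (hA : A ≠ 0) :
    GeneratesLegendrian (𝓡 n) (fun p : M × EuclideanSpace ℝ (Fin N) => A p.2) ∅ := by
  refine ⟨⟨A.contDiff.contMDiff.comp contMDiff_snd, fun p hp => ?_⟩, ?_⟩
  · rw [dFiber_snd] at hp
    exact absurd hp hA
  · have : fiberCrit (fun p : M × EuclideanSpace ℝ (Fin N) => A p.2) = ∅ := by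
      ext p
      simp only [fiberCrit, dFiber_snd, mem_ofPred_eq, hA, mem_empty_iff_false]
    rw [this, image_empty]

variable [T2Space M] [IsManifold (𝓡 n) ∞ M]

theorem isImmersedGFCobordism_interpolation {Λ : Set (OneJet (𝓡 n) M)}
    (hf : GeneratesLegendrian (𝓡 n) f Λ) (hA : AgreesAtInfinity f A)
    (hσ0 : ∀ t ≤ 1, σ t = 0) (hσ1 : ∀ t, 2 ≤ t → σ t = 1)
    (hρ0 : ∀ t ≤ 1 / 2, ρ t = 0) (hρ3 : ∀ t, 3 ≤ t → ρ t = 0) (hρn : ∀ t, |ρ t| ≤ 1)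
    (heA : ‖e‖ < ‖A‖)
    (hF : IsGeneratingFamily (cylModel n)
      (interpolation f A σ fun t => (t * ρ t) • e : (RPos × M) × EuclideanSpace ℝ (Fin N) → ℝ)) :
    IsImmersedGFCobordism ∅ (fun p => A p.2)
      (iMap (cylModel n) (interpolation f A σ fun t => (t * ρ t) • e) ''
        fiberCrit (interpolation f A σ fun t => (t * ρ t) • e))
      (interpolation f A σ fun t => (t * ρ t) • e) Λ f := by
  obtain ⟨K, hK, hKA⟩ := hA
  have hA0 : A ≠ 0 := by
    rintro rfl
    exact absurd heA (not_lt.2 (by simp))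
  have hρe : ∀ t, A - ρ t • e ≠ 0 := fun t h => by
    have h1 : ‖ρ t • e‖ ≤ ‖e‖ := by
      rw [norm_smul]
      exact mul_le_of_le_one_left (norm_nonneg _) (hρn t)
    rw [← sub_eq_zero.1 h] at h1
    exact absurd heA (not_lt.2 h1)
  have hd : ∀ p : (RPos × M) × EuclideanSpace ℝ (Fin N),
      dFiber (interpolation f A σ fun t => (t * ρ t) • e) p = 0 ↔
        interpolationDeriv f A σ p = ρ p.1.1 • e := fun p => by
    have ht : (p.1.1 : ℝ) ≠ 0 := (show (0 : ℝ) < p.1.1 from p.1.1.2).ne'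
    have h : dFiber (interpolation f A σ fun t => (t * ρ t) • e) p =
        (p.1.1 : ℝ) • (interpolationDeriv f A σ p - ρ p.1.1 • e) := by
      rw [dFiber_interpolation hf.1.1, smul_sub, smul_smul]
    rw [h, smul_eq_zero, sub_eq_zero]
    exact or_iff_right ht
  have hcritK : ∀ p ∈ fiberCrit (interpolation f A σ fun t => (t * ρ t) • e :
      (RPos × M) × EuclideanSpace ℝ (Fin N) → ℝ), (p.1.2, p.2) ∈ K := fun p hp => by
    -- Off `K` both `∂_η f` and the interpolated derivative equal `A`, so a critical point would
    -- give `A = ρ e`.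
    by_contra hpK
    have h1 := (hd p).1 hp
    rw [interpolationDeriv, dFiber_eq_of_notMem hK.isClosed hKA hpK, ← add_smul,
      add_sub_cancel, one_smul] at h1
    exact hρe _ (sub_eq_zero.2 h1)
  have hlow : ∀ p ∈ fiberCrit (interpolation f A σ fun t => (t * ρ t) • e :
      (RPos × M) × EuclideanSpace ℝ (Fin N) → ℝ), 1 < (p.1.1 : ℝ) := fun p hp => by
    by_contra! h
    have h1 := (hd p).1 hp
    rw [interpolationDeriv, hσ0 _ h, zero_smul, zero_add, sub_zero, one_smul] at h1
    exact hρe _ (sub_eq_zero.2 h1)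
  have hup : ∀ p : (RPos × M) × EuclideanSpace ℝ (Fin N), 3 ≤ (p.1.1 : ℝ) →
      interpolation f A σ (fun t => (t * ρ t) • e) p = (p.1.1 : ℝ) * f (p.1.2, p.2) := fun p hp => by
    simp [interpolation, hσ1 _ (show (2 : ℝ) ≤ p.1.1 by linarith), hρ3 _ hp]
  -- At `t ≤ 1/2` both cutoffs vanish and `F = t A`. The upper bound is `4` because `F = t f` from
  -- `3` on, leaving an open margin for derivatives in `t`.
  refine ⟨generatesLegendrian_empty hA0, hf, ⟨hF, rfl⟩, ⟨A, hA0, ∅, isCompact_empty, fun _ _ => rfl⟩,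
    ⟨A, hA0, K, hK, hKA⟩, fun t => ?_, 1 / 2, 4, ?_, fun t x η => ⟨fun ht => ?_, fun ht => ?_⟩⟩
  · refine ⟨(t : ℝ) • (A - ρ t • e),
      smul_ne_zero (show (0 : ℝ) < t from t.2).ne' (hρe t), K, hK, fun p hp => ?_⟩
    simp only [interpolation, hKA _ hp, smul_apply,
      sub_apply, smul_eq_mul]
    ring
  · refine ⟨isLagrangianImmersion_iMap hF, rfl, by norm_num, by norm_num, ?_, ?_, ?_⟩
    · rw [prod_empty, image_empty]
      refine eq_empty_of_forall_notMem ?_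
      rintro _ ⟨⟨p, hp, rfl⟩, ht⟩
      have ht' : (p.1.1 : ℝ) ≤ 1 / 2 := ht
      linarith [hlow p hp]
    · rw [hf.2]
      exact image_fiberCrit_upper_end hf.1.1 (by norm_num) (by norm_num : (3 : ℝ) < 4) hup
    · exact isCompact_fiberCrit_inter (contMDiff_dFiber hF.1).continuous hK hcritK (by norm_num)
  · simp [interpolation, hσ0 _ (show (t : ℝ) ≤ 1 by linarith), hρ0 _ ht]
  · exact hup ((t, x), η) (by simpa using by linarith)

end Filling

/-! ### The plateau function -/

section Cutoff

/-- A smooth function which is `1` on `[1, 2]` and vanishes outside `(1/2, 3)`. -/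
noncomputable def plateau (t : ℝ) : ℝ :=
  Real.smoothTransition (2 * t - 1) * Real.smoothTransition (3 - t)

theorem contDiff_plateau : ContDiff ℝ ∞ plateau :=
  (Real.smoothTransition.contDiff.comp ((contDiff_const.mul contDiff_id).sub contDiff_const)).mul
    (Real.smoothTransition.contDiff.comp (contDiff_const.sub contDiff_id))

theorem plateau_eq_zero_of_le {t : ℝ} (ht : t ≤ 1 / 2) : plateau t = 0 := by
  rw [plateau, Real.smoothTransition.zero_of_nonpos (by linarith), zero_mul]

theorem plateau_eq_zero_of_ge {t : ℝ} (ht : 3 ≤ t) : plateau t = 0 := by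
  rw [plateau, Real.smoothTransition.zero_of_nonpos (x := 3 - t) (by linarith), mul_zero]

theorem plateau_eq_one {t : ℝ} (h1 : 1 ≤ t) (h2 : t ≤ 2) : plateau t = 1 := by
  rw [plateau, Real.smoothTransition.one_of_one_le (by linarith),
    Real.smoothTransition.one_of_one_le (by linarith), mul_one]

theorem abs_plateau_le_one (t : ℝ) : |plateau t| ≤ 1 := by
  rw [plateau, abs_of_nonneg (mul_nonneg (Real.smoothTransition.nonneg _)
    (Real.smoothTransition.nonneg _))]
  exact mul_le_one₀ (Real.smoothTransition.le_one _) (Real.smoothTransition.nonneg _)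
    (Real.smoothTransition.le_one _)

/-- This gives `‖ε(t)‖ ≤ 3 ‖e‖` and is the origin of the bound `δ / 3` on `‖e‖`. -/
theorem abs_mul_plateau_le (t : ℝ) : |t * plateau t| ≤ 3 := by
  rcases le_or_gt t (1 / 2) with h | h
  · simp [plateau_eq_zero_of_le h]
  rcases le_or_gt 3 t with h' | h'
  · simp [plateau_eq_zero_of_ge h']
  · rw [abs_mul, abs_of_pos (by linarith)]
    nlinarith [abs_plateau_le_one t, abs_nonneg (plateau t)]

end Cutoff

end GF

theorem proposition3p1 {n N : ℕ} {M : Type*} [TopologicalSpace M] [T2Space M]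
    [SecondCountableTopology M] [ChartedSpace (EuclideanSpace ℝ (Fin n)) M]
    [IsManifold (𝓡 n) ∞ M]
    (Λ : Set (GF.OneJet (𝓡 n) M)) (f : M × EuclideanSpace ℝ (Fin N) → ℝ)
    (hf : GF.GeneratesLegendrian (𝓡 n) f Λ) (hlin : GF.IsLinearAtInfinity f) :
    ∃ (A : EuclideanSpace ℝ (Fin N) →L[ℝ] ℝ)
      (L : Set (GF.Cotangent (GF.cylModel n) (GF.RPos × M)))
      (F : (GF.RPos × M) × EuclideanSpace ℝ (Fin N) → ℝ),
      A ≠ 0 ∧ GF.AgreesAtInfinity f A ∧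
      GF.IsImmersedGFCobordism ∅ (fun p => A p.2) L F Λ f ∧
      ∃ (σ : ℝ → ℝ) (ε : ℝ → EuclideanSpace ℝ (Fin N) →L[ℝ] ℝ),
        ContDiff ℝ ∞ σ ∧ Monotone σ ∧ (∀ t ≤ 1, σ t = 0) ∧ (∀ t, 2 ≤ t → σ t = 1) ∧
        ContDiff ℝ ∞ ε ∧ (∀ t, GF.IsFiberRegularValue (𝓡 n) f (ε t)) ∧
        ∀ (t : GF.RPos) (x : M) (η : EuclideanSpace ℝ (Fin N)),
          F ((t, x), η) = t * (σ t * f (x, η) + (1 - σ t) * A η) - ε t η := by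
  obtain ⟨A, hA0, hA⟩ := hlin
  obtain ⟨δ, hδ, hreg⟩ := GF.exists_forall_norm_lt_isFiberRegularValue hf.1 hA0 hA
  let σ : ℝ → ℝ := fun t => Real.smoothTransition (t - 1)
  have hσ : ContDiff ℝ ∞ σ :=
    Real.smoothTransition.contDiff.comp (contDiff_id.sub contDiff_const)
  have hσ0 : ∀ t ≤ 1, σ t = 0 := fun t ht =>
    Real.smoothTransition.zero_of_nonpos (by linarith)
  have hσ1 : ∀ t, 2 ≤ t → σ t = 1 := fun t ht =>
    Real.smoothTransition.one_of_one_le (by linarith)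
  -- `‖e‖ < δ / 3` keeps the path `ε(t) = t ρ(t) e` among the regular values of `∂_η f`; `‖e‖ < ‖A‖`
  -- excludes critical points below `t = 1` and off `K`.
  obtain ⟨e, he, hei⟩ := GF.exists_norm_lt_regular_value
    (GF.contMDiff_interpolationDeriv (A := A) hf.1.1 hσ)
    (lt_min (by positivity : 0 < δ / 3) (norm_pos_iff.2 hA0))
  have heδ : ‖e‖ < δ / 3 := he.trans_le (min_le_left _ _)
  have heA : ‖e‖ < ‖A‖ := he.trans_le (min_le_right _ _)
  have hF := GF.isGeneratingFamily_interpolation hf.1 hσ hσ0 hσ1 GF.contDiff_plateau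
    (fun _ => GF.plateau_eq_one) GF.abs_plateau_le_one heA
    (fun c hc => hreg c (by linarith)) hei
  refine ⟨A, _, _, hA0, hA, GF.isImmersedGFCobordism_interpolation hf hA hσ0 hσ1
    (fun _ => GF.plateau_eq_zero_of_le) (fun _ => GF.plateau_eq_zero_of_ge)
    GF.abs_plateau_le_one heA hF, σ, fun t => (t * GF.plateau t) • e, hσ,
    fun s t hst => Real.smoothTransition.monotone (by linarith), hσ0, hσ1,
    (contDiff_id.mul GF.contDiff_plateau).smul contDiff_const, fun t => hreg _ ?_,
    fun t x η => rfl⟩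
  rw [norm_smul, Real.norm_eq_abs]
  nlinarith [GF.abs_mul_plateau_le t, norm_nonneg e]
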